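/- Let $\mathbb R^m$ carry the Euclidean norm and square matrices the spectral norm. **Function classes.** For $p\in\mathbb N$, $p\ge 1$, and $\omega>0$, let $\mathcal S(p,\omega)$ be the set of strictly increasing real sequences $\theta=\{\theta_k\}_{k\in\mathbb Z}$ with $\theta_{k+p}=\theta_k+\omega$ for all $k\in\mathbb Z$. Let $\mathcal{BPC}(\theta)$ be the set of bounded functions $\varphi:\mathbb R\to\mathbb R^m$ such that for every $k\in\mathbb Z$, $\varphi$ is continuous on $(\theta_{k-1},\theta_k)$, the limit $\varphi(\theta_k+)=\lim_{t\to\theta_k^+}\varphi(t)$ exists, and $\varphi(\theta_k)=\lim_{t\to\theta_k^-}\varphi(t)$. A function $\psi\in\mathcal{BPC}(\theta)$ is *unpredictable* if there are $\varepsilon_0,\nu>0$ and real sequences $\mu_n\to\infty$, $\tau_n\to\infty$ such that (i) for every $\varepsilon>0$ there is $\delta>0$ with $\|\psi(s_1)-\psi(s_2)\|<\varepsilon$ whenever $s_1,s_2$ lie in the same interval $(\theta_{k-1},\theta_k)$ and $|s_1-s_2|<\delta$; (ii) $\|\psi(t+\mu_n)-\psi(t)\|\to0$ as $n\to\infty$,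 uniformly on compact subsets of $\mathbb R$; (iii) $\|\psi(t+\mu_n)-\psi(t)\|\ge\varepsilon_0$ for all $t\in[\tau_n-\nu,\tau_n+\nu]$ and all $n$. A function $\phi\in\mathcal{BPC}(\theta)$ is *asymptotically unpredictable* if $\phi=\psi+\xi$ with $\psi\in\mathcal{BPC}(\theta)$ unpredictable and $\xi\in\mathcal{BPC}(\theta)$, $\|\xi(t)\|\to0$ as $t\to\infty$. A bounded sequence $\{\alpha_k\}_{k\in\mathbb Z}$ in $\mathbb R^m$ is *unpredictable* if there are $\upsilon_0>0$ and sequences of positive integers $q_n\to\infty$, $r_n\to\infty$ such that $\|\alpha_{k+q_n}-\alpha_k\|\to0$ as $n\to\infty$ for each $k$ (equivalently, uniformly for $k$ in bounded intervals of integers) and $\|\alpha_{q_n+r_n}-\alpha_{r_n}\|\ge\upsilon_0$ for all $n$. A bounded sequence $\{\sigma_k\}_{k\in\mathbb Z}$ is *asymptotically unpredictable* if $\sigma_k=\alpha_k+\beta_k$ for all $k$, with $\{\alpha_k\}$ unpredictable and $\|\beta_k\|\to0$ as $k\to\infty$. **The system.** Let $\theta\in\mathcal S(p,\omega)$, let $A,B$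 be commuting real $m\times m$ matrices, let $f:\mathbb R\times\mathbb R^m\to\mathbb R^m$ and $h:\mathbb R^m\to\mathbb R^m$ be continuous, let $\{\gamma_k\}_{k\in\mathbb Z}$ be a bounded sequence in $\mathbb R^m$ with $\|\gamma_k\|\to0$ as $k\to\infty$, let $g_1(t)=\sigma_k$ for $\theta_{kp}<t\le\theta_{(k+1)p}$, $k\in\mathbb Z$, where $\{\sigma_k\}_{k\in\mathbb Z}$ is a bounded sequence in $\mathbb R^m$, and let $g_2\in\mathcal{BPC}(\theta)$ with $\|g_2(t)\|\to0$ as $t\to\infty$. Consider $$x'(t)=Ax(t)+f(t,x(t))+g_1(t)+g_2(t),\quad t\ne\theta_k,\qquad \Delta x|_{t=\theta_k}=Bx(\theta_k)+h(x(\theta_k))+\gamma_k,$$ where $\Delta x|_{t=\theta_k}=x(\theta_k+)-x(\theta_k)$ and solutions are left-continuous at the moments $\theta_k$. Put $U(t,s)=e^{A(t-s)}(I+B)^{i([s,t))}$ for $t\ge s$, where $i(J)$ is the number of the $\theta_k$ in $J$; this is the matriciant of the linear system $x'=Ax$ ($t\neq\theta_k$), $\Delta x|_{t=\theta_k}=Bx(\theta_k)$.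 **Assumptions.** - (A1) $\det(I+B)\ne0$. - (A2) All eigenvalues of $A+\frac p\omega\operatorname{Log}(I+B)$ have negative real part, where $\operatorname{Log}$ is the principal matrix logarithm, the one whose eigenvalues have imaginary part in $(-\pi,\pi]$. - (A3) $f(t+\omega,x)=f(t,x)$ for all $(t,x)$. - (A4) $\|f(t,x)\|\le M_f$ for $(t,x)\in[0,\omega)\times\mathbb R^m$ and $\|h(x)\|\le M_h$ for $x\in\mathbb R^m$, for some $M_f,M_h>0$. - (A5) $\|f(t,x_1)-f(t,x_2)\|\le L_f\|x_1-x_2\|$ and $\|h(x_1)-h(x_2)\|\le L_h\|x_1-x_2\|$ for all $t,x_1,x_2$, for some $L_f,L_h>0$. Let $N\ge1$ and $\lambda>0$ be numbers with $\|U(t,s)\|\le Ne^{-\lambda(t-s)}$ for all $t\ge s$ (such numbers exist by (A1) and (A2)), and suppose that - (A6) $N\Big(\dfrac{L_f}{\lambda}+\dfrac{pL_h}{1-e^{-\lambda\omega}}\Big)<1$. - (A7) $NL_f+\dfrac p\omega\ln(1+NL_h)<\lambda$. - (A8) $L_h\|(I+B)^{-1}\|<1$. **Theorem.** Under (A1)–(A8),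 if $\{\sigma_k\}_{k\in\mathbb Z}$ is asymptotically unpredictable, then the impulsive system has a unique asymptotically unpredictable solution $\phi\in\mathcal{BPC}(\theta)$ on $\mathbb R$. Moreover, $\phi$ is asymptotically stable: for every $t_0\in\mathbb R$, (a) for every $\varepsilon>0$ there is $\delta>0$ such that every solution $x$ on $[t_0,\infty)$ with $\|x(t_0)-\phi(t_0)\|<\delta$ satisfies $\|x(t)-\phi(t)\|<\varepsilon$ for all $t\ge t_0$, and (b) there is $\delta>0$ such that every solution $x$ on $[t_0,\infty)$ with $\|x(t_0)-\phi(t_0)\|<\delta$ satisfies $\|x(t)-\phi(t)\|\to0$ as $t\to\infty$. -/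

import Mathlib

open Set Filter Topology
open scoped Matrix.Norms.L2Operator

/-- The set `𝒮(p, ω)` of impulse moments: strictly increasing two-sided real sequences with
`θ (k + p) = θ k + ω` for all integers `k`. -/
def RegularMoments (p : ℕ) (ω : ℝ) : Set (ℤ → ℝ) :=
  {θ | 0 < p ∧ 0 < ω ∧ StrictMono θ ∧ ∀ k : ℤ, θ (k + p) = θ k + ω}

/-- The set `ℬ𝒫𝒞(θ)`: bounded functions on the real line that are continuous on each
`(θ (k - 1), θ k)`, have a right limit at each `θ k` and are left-continuous at each `θ k`. -/
def BPC {m : ℕ} (θ : ℤ → ℝ) : Set (ℝ → EuclideanSpace ℝ (Fin m)) :=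
  {φ | (∃ C : ℝ, ∀ t, ‖φ t‖ ≤ C) ∧
    (∀ k : ℤ, ContinuousOn φ (Ioo (θ (k - 1)) (θ k))) ∧
    (∀ k : ℤ, ∃ l, Tendsto φ (𝓝[>] θ k) (𝓝 l)) ∧
    ∀ k : ℤ, Tendsto φ (𝓝[<] θ k) (𝓝 (φ (θ k)))}

/-- Piecewise continuous unpredictable functions. -/
def IsUnpredictable {m : ℕ} (θ : ℤ → ℝ) (ψ : ℝ → EuclideanSpace ℝ (Fin m)) : Prop :=
  ψ ∈ BPC θ ∧
  ∃ (ε₀ ν : ℝ) (μ τ : ℕ → ℝ), 0 < ε₀ ∧ 0 < ν ∧ Tendsto μ atTop atTop ∧ Tendsto τ atTop atTop ∧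
    (∀ ε > 0, ∃ δ > 0, ∀ k : ℤ, ∀ s₁ ∈ Ioo (θ (k - 1)) (θ k), ∀ s₂ ∈ Ioo (θ (k - 1)) (θ k),
      |s₁ - s₂| < δ → ‖ψ s₁ - ψ s₂‖ < ε) ∧
    (∀ K : Set ℝ, IsCompact K →
      TendstoUniformlyOn (fun (n : ℕ) (t : ℝ) => ‖ψ (t + μ n) - ψ t‖) (fun _ => 0) atTop K) ∧
    ∀ n : ℕ, ∀ t ∈ Icc (τ n - ν) (τ n + ν), ε₀ ≤ ‖ψ (t + μ n) - ψ t‖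

/-- Piecewise continuous asymptotically unpredictable functions: an unpredictable function plus
a function in `ℬ𝒫𝒞(θ)` that vanishes at `+∞`. -/
def IsAsymptoticallyUnpredictable {m : ℕ} (θ : ℤ → ℝ) (φ : ℝ → EuclideanSpace ℝ (Fin m)) :
    Prop :=
  φ ∈ BPC θ ∧ ∃ ψ ξ : ℝ → EuclideanSpace ℝ (Fin m), IsUnpredictable θ ψ ∧ ξ ∈ BPC θ ∧
    Tendsto (fun t => ‖ξ t‖) atTop (𝓝 0) ∧ ∀ t, φ t = ψ t + ξ t

/-- Unpredictable two-sided sequences. -/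
def IsUnpredictableSeq {m : ℕ} (α : ℤ → EuclideanSpace ℝ (Fin m)) : Prop :=
  (∃ C : ℝ, ∀ k, ‖α k‖ ≤ C) ∧
  ∃ (υ₀ : ℝ) (q r : ℕ → ℕ), 0 < υ₀ ∧ (∀ n, 0 < q n) ∧ (∀ n, 0 < r n) ∧
    Tendsto q atTop atTop ∧ Tendsto r atTop atTop ∧
    (∀ k : ℤ, Tendsto (fun n => ‖α (k + q n) - α k‖) atTop (𝓝 0)) ∧
    ∀ n : ℕ, υ₀ ≤ ‖α (q n + r n) - α (r n)‖

/-- Asymptotically unpredictable two-sided sequences. -/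
def IsAsymptoticallyUnpredictableSeq {m : ℕ} (σ : ℤ → EuclideanSpace ℝ (Fin m)) : Prop :=
  (∃ C : ℝ, ∀ k, ‖σ k‖ ≤ C) ∧
  ∃ α β : ℤ → EuclideanSpace ℝ (Fin m), IsUnpredictableSeq α ∧
    Tendsto (fun k => ‖β k‖) atTop (𝓝 0) ∧ ∀ k, σ k = α k + β k

/-- `x` solves the impulsive system `x' = F(t, x)` for `t ≠ θ k`, `Δx = G k (x (θ k))` at
`t = θ k`, on the interval `J` (below, `J` is the real line or `[t₀, ∞)`). Here
`Δx = x(θ k +) - x(θ k)` and `x` is left-continuous at the impulse moments. If `J = [t₀, ∞)` and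
`t₀` is an impulse moment, then `x t₀` is the value before the jump. -/
def IsImpulsiveSolution {m : ℕ} (θ : ℤ → ℝ)
    (F : ℝ → EuclideanSpace ℝ (Fin m) → EuclideanSpace ℝ (Fin m))
    (G : ℤ → EuclideanSpace ℝ (Fin m) → EuclideanSpace ℝ (Fin m))
    (J : Set ℝ) (x : ℝ → EuclideanSpace ℝ (Fin m)) : Prop :=
  (∀ t ∈ J, t ∉ range θ → HasDerivWithinAt x (F t (x t)) J t) ∧
  (∀ k : ℤ, θ k ∈ J → Tendsto x (𝓝[J ∩ Iio (θ k)] θ k) (𝓝 (x (θ k)))) ∧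
  ∀ k : ℤ, θ k ∈ J →
    Tendsto x (𝓝[J ∩ Ioi (θ k)] θ k) (𝓝 (x (θ k) + G k (x (θ k))))

/-- Lyapunov asymptotic stability of a solution `φ` of an impulsive system: for every initial
moment `t₀`, `φ` is stable and attracts all solutions on `[t₀, ∞)` that start near `φ t₀`. -/
def IsAsymptoticallyStable {m : ℕ} (θ : ℤ → ℝ)
    (F : ℝ → EuclideanSpace ℝ (Fin m) → EuclideanSpace ℝ (Fin m))
    (G : ℤ → EuclideanSpace ℝ (Fin m) → EuclideanSpace ℝ (Fin m))
    (φ : ℝ → EuclideanSpace ℝ (Fin m)) : Prop :=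
  ∀ t₀ : ℝ,
    (∀ ε > 0, ∃ δ > 0, ∀ x, IsImpulsiveSolution θ F G (Ici t₀) x → ‖x t₀ - φ t₀‖ < δ →
      ∀ t ≥ t₀, ‖x t - φ t‖ < ε) ∧
    ∃ δ > 0, ∀ x, IsImpulsiveSolution θ F G (Ici t₀) x → ‖x t₀ - φ t₀‖ < δ →
      Tendsto (fun t => ‖x t - φ t‖) atTop (𝓝 0)

/-- The right-hand side `A x + f(t, x) + g₁(t) + g₂(t)`. -/
noncomputable def quasilinearField {m : ℕ} (A : Matrix (Fin m) (Fin m) ℝ)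
    (f : ℝ → EuclideanSpace ℝ (Fin m) → EuclideanSpace ℝ (Fin m))
    (g₁ g₂ : ℝ → EuclideanSpace ℝ (Fin m)) (t : ℝ) (x : EuclideanSpace ℝ (Fin m)) :
    EuclideanSpace ℝ (Fin m) :=
  Matrix.toEuclideanCLM (𝕜 := ℝ) A x + f t x + g₁ t + g₂ t

/-- The impulse action `B x + h(x) + γ k`. -/
noncomputable def quasilinearJump {m : ℕ} (B : Matrix (Fin m) (Fin m) ℝ)
    (h : EuclideanSpace ℝ (Fin m) → EuclideanSpace ℝ (Fin m))
    (γ : ℤ → EuclideanSpace ℝ (Fin m)) (k : ℤ) (x : EuclideanSpace ℝ (Fin m)) :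
    EuclideanSpace ℝ (Fin m) :=
  Matrix.toEuclideanCLM (𝕜 := ℝ) B x + h x + γ k

/-- `i(J)`: the number of terms of the sequence `θ` that belong to `J`. -/
noncomputable def countMoments (θ : ℤ → ℝ) (J : Set ℝ) : ℕ := {k : ℤ | θ k ∈ J}.ncard

/-- The matriciant `U(t, s) = exp (A (t - s)) (I + B) ^ i([s, t))`, `t ≥ s`, of the linear
impulsive system `x' = A x` for `t ≠ θ k`, `Δx = B x` at `t = θ k`, for commuting `A` and `B`;
see `matriciant_isImpulsiveSolution` below. -/
noncomputable def matriciant {m : ℕ} (A B : Matrix (Fin m) (Fin m) ℝ) (θ : ℤ → ℝ) (t s : ℝ) :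
    Matrix (Fin m) (Fin m) ℝ :=
  NormedSpace.exp ((t - s) • A) * (1 + B) ^ countMoments θ (Ico s t)

/-- `L` is the principal logarithm of the complex matrix `M`: `exp L = M` and every eigenvalue
of `L` has its imaginary part in `(-π, π]`. -/
def IsPrincipalLog {m : ℕ} (M L : Matrix (Fin m) (Fin m) ℂ) : Prop :=
  NormedSpace.exp L = M ∧ ∀ z ∈ spectrum ℂ L, -Real.pi < z.im ∧ z.im ≤ Real.pi

theorem matriciant_self {m : ℕ} (A B : Matrix (Fin m) (Fin m) ℝ) (θ : ℤ → ℝ) (s : ℝ) :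
    matriciant A B θ s s = 1 := by
  simp [matriciant, countMoments]

theorem RegularMoments.shift {p : ℕ} {ω : ℝ} {θ : ℤ → ℝ} (hθ : θ ∈ RegularMoments p ω) (n : ℕ)
    (k : ℤ) : θ (k + n * p) = θ k + n * ω := by
  induction n with
  | zero => simp
  | succ n ih =>
    have h := hθ.2.2.2 (k + n * p)
    rw [ih] at h
    have e : k + ((n + 1 : ℕ) : ℤ) * p = k + n * p + p := by push_cast; ring
    rw [e, h]; push_cast; ring

theorem RegularMoments.exists_mem_Ioc {p : ℕ} {ω : ℝ} {θ : ℤ → ℝ} (hθ : θ ∈ RegularMoments p ω)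
    (t : ℝ) : ∃ k : ℤ, t ∈ Ioc (θ k) (θ (k + 1)) := by
  have hω := hθ.2.1
  have hm := hθ.2.2.1
  obtain ⟨n, hn⟩ := exists_nat_gt ((t - θ 0) / ω)
  obtain ⟨n', hn'⟩ := exists_nat_gt ((θ 0 - t) / ω)
  rw [div_lt_iff₀ hω] at hn hn'
  have h1 := RegularMoments.shift hθ n 0
  have h2 := RegularMoments.shift hθ n' (-(n' * p : ℤ))
  have h3 : -(n' * p : ℤ) + n' * p = 0 := by ring
  rw [h3] at h2
  obtain ⟨k, hk, hk'⟩ := Int.exists_greatest_of_bdd (P := fun k => θ k < t)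
    ⟨0 + n * p, fun z hz => by
      by_contra hc
      have := hm (not_le.mp hc)
      linarith⟩
    ⟨-(n' * p : ℤ), by linarith⟩
  refine ⟨k, hk, ?_⟩
  by_contra hc
  have := hk' (k + 1) (not_le.mp hc)
  omega

theorem RegularMoments.finite {p : ℕ} {ω : ℝ} {θ : ℤ → ℝ} (hθ : θ ∈ RegularMoments p ω)
    (s : ℝ) (k : ℤ) : {j : ℤ | s ≤ θ j ∧ j ≤ k}.Finite := by
  obtain ⟨l, hl⟩ := RegularMoments.exists_mem_Ioc hθ s
  refine (finite_Icc l k).subset fun j hj => ⟨?_, hj.2⟩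
  by_contra hc
  have := hθ.2.2.1 (not_le.mp hc)
  linarith [hl.1, hj.1]

theorem countMoments_eq {θ : ℤ → ℝ} (hm : StrictMono θ) (s : ℝ) {k : ℤ} {t : ℝ}
    (ht : t ∈ Ioc (θ k) (θ (k + 1))) :
    countMoments θ (Ico s t) = {j : ℤ | s ≤ θ j ∧ j ≤ k}.ncard := by
  unfold countMoments
  congr 1
  ext j
  simp only [mem_ofPred_eq, mem_Ico, and_congr_right_iff]
  intro _
  constructor
  · intro h
    have := hm.lt_iff_lt.mp (h.trans_le ht.2)
    omega
  · intro h
    exact (hm.monotone h).trans_lt ht.1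

/-- The closed form above is the matriciant: `U(s, s) = I`, and each `t ↦ U(t, s) v` solves the
linear homogeneous impulsive system on `[s, ∞)`. -/
theorem matriciant_isImpulsiveSolution {m p : ℕ} {ω : ℝ} {θ : ℤ → ℝ}
    (hθ : θ ∈ RegularMoments p ω) (A B : Matrix (Fin m) (Fin m) ℝ) (hAB : Commute A B) (s : ℝ)
    (v : EuclideanSpace ℝ (Fin m)) :
    IsImpulsiveSolution θ (fun _ x => Matrix.toEuclideanCLM (𝕜 := ℝ) A x)
      (fun _ x => Matrix.toEuclideanCLM (𝕜 := ℝ) B x) (Ici s)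
      (fun t => Matrix.toEuclideanCLM (𝕜 := ℝ) (matriciant A B θ t s) v) := by
  have hm := hθ.2.2.1
  set c : ℤ → ℕ := fun k => {j : ℤ | s ≤ θ j ∧ j ≤ k}.ncard with hc
  set y : ℤ → ℝ → EuclideanSpace ℝ (Fin m) := fun k u =>
    Matrix.toEuclideanCLM (𝕜 := ℝ) (NormedSpace.exp ((u - s) • A) * (1 + B) ^ c k) v with hy
  have hxy : ∀ k, ∀ u ∈ Ioc (θ k) (θ (k + 1)),
      Matrix.toEuclideanCLM (𝕜 := ℝ) (matriciant A B θ u s) v = y k u := by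
    intro k u hu
    simp only [hy, matriciant, countMoments_eq hm s hu, hc]
  have hd : ∀ k u, HasDerivAt (y k) (Matrix.toEuclideanCLM (𝕜 := ℝ) A (y k u)) u := by
    intro k u
    have h1 : HasDerivAt (fun w : ℝ => NormedSpace.exp (w • A))
        (A * NormedSpace.exp ((u - s) • A)) (u - s) := hasDerivAt_exp_smul_const' A (u - s)
    have h2 := (h1.comp_sub_const u s).mul_const ((1 + B) ^ c k)
    let T : Matrix (Fin m) (Fin m) ℝ →ₗ[ℝ] EuclideanSpace ℝ (Fin m) :=
      { toFun := fun M => Matrix.toEuclideanCLM (𝕜 := ℝ) M v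
        map_add' := by intros; simp
        map_smul' := by intros; simp }
    have h3 := (LinearMap.toContinuousLinearMap T).hasFDerivAt.comp_hasDerivAt u h2
    refine h3.congr_deriv ?_
    simp [T, hy, mul_assoc]
  have hcont : ∀ k u, ContinuousAt (y k) u := fun k u => (hd k u).continuousAt
  refine ⟨?_, ?_, ?_⟩
  · intro t ht htr
    obtain ⟨k, hk⟩ := RegularMoments.exists_mem_Ioc hθ t
    have hk' : t ∈ Ioo (θ k) (θ (k + 1)) :=
      ⟨hk.1, lt_of_le_of_ne hk.2 fun e => htr ⟨_, e.symm⟩⟩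
    have he : (fun t => Matrix.toEuclideanCLM (𝕜 := ℝ) (matriciant A B θ t s) v) =ᶠ[𝓝 t] y k := by
      filter_upwards [isOpen_Ioo.mem_nhds hk'] with u hu
      exact hxy k u ⟨hu.1, hu.2.le⟩
    have h1 := (hd k t).congr_of_eventuallyEq he
    rw [← hxy k t hk] at h1
    exact h1.hasDerivWithinAt
  · intro k _
    have hk : θ (k - 1) < θ k := hm (by omega)
    have hk1 : θ (k - 1 + 1) = θ k := by congr 1; ring
    have h1 : Tendsto (y (k - 1)) (𝓝[<] θ k) (𝓝 (y (k - 1) (θ k))) :=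
      (hcont (k - 1) (θ k)).tendsto.mono_left nhdsWithin_le_nhds
    rw [← hxy (k - 1) (θ k) ⟨hk, hk1.ge⟩] at h1
    refine (h1.congr' ?_).mono_left (nhdsWithin_mono _ inter_subset_right)
    filter_upwards [Ioo_mem_nhdsLT hk] with u hu
    exact (hxy (k - 1) u ⟨hu.1, by rw [hk1]; exact hu.2.le⟩).symm
  · intro k hks
    have hk : θ (k - 1) < θ k := hm (by omega)
    have hk1 : θ (k - 1 + 1) = θ k := by congr 1; ring
    have hk2 : θ k < θ (k + 1) := hm (by omega)
    have hcc : c k = c (k - 1) + 1 := by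
      have e : {j : ℤ | s ≤ θ j ∧ j ≤ k} = insert k {j : ℤ | s ≤ θ j ∧ j ≤ k - 1} := by
        ext j
        simp only [mem_ofPred_eq, mem_insert_iff]
        constructor
        · rintro ⟨h1, h2⟩
          rcases eq_or_lt_of_le h2 with h | h
          · exact Or.inl h
          · exact Or.inr ⟨h1, by omega⟩
        · rintro (rfl | ⟨h1, h2⟩)
          · exact ⟨hks, le_rfl⟩
          · exact ⟨h1, by omega⟩
      simp only [hc]
      rw [e, ncard_insert_of_notMem (by simp) (RegularMoments.finite hθ s (k - 1))]
    have h1 : Tendsto (y k) (𝓝[>] θ k) (𝓝 (y k (θ k))) :=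
      (hcont k (θ k)).tendsto.mono_left nhdsWithin_le_nhds
    have hval : y k (θ k) = y (k - 1) (θ k) + Matrix.toEuclideanCLM (𝕜 := ℝ) B (y (k - 1) (θ k)) := by
      have hcm : Commute (1 + B) (NormedSpace.exp ((θ k - s) • A)) :=
        ((Commute.one_left _).add_left
          ((hAB.symm.smul_right (θ k - s)).exp_right))
      have e : NormedSpace.exp ((θ k - s) • A) * (1 + B) ^ c k =
          (1 + B) * (NormedSpace.exp ((θ k - s) • A) * (1 + B) ^ c (k - 1)) := by
        rw [hcc, pow_succ', ← mul_assoc, ← mul_assoc, hcm.eq]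
      simp only [hy]
      rw [e]
      simp [add_mul]
    rw [hval, ← hxy (k - 1) (θ k) ⟨hk, hk1.ge⟩] at h1
    refine (h1.congr' ?_).mono_left (nhdsWithin_mono _ inter_subset_right)
    filter_upwards [Ioo_mem_nhdsGT hk2] with u hu
    exact (hxy k u ⟨hu.1, hu.2.le⟩).symm

/-! The smallness condition makes the quasilinear system uniformly contracting: two solutions
started at time `s` approach each other like `exp (-κ * (t - s))`, up to a constant times the
difference of their forcings. This is `PerturbationBound`, proved in `exists_perturbationBound`.
Variation of constants (`IsImpulsiveSolution.norm_le`) turns a bound on a perturbed solution into a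
better one with contraction factor `q < 1`, and iteration leaves a constant independent of the
solution.

The rest applies this estimate to suitable pairs of solutions. Solutions started from zero at ever
earlier moments form a Cauchy sequence, which gives a bounded solution on the line
(`PerturbationBound.exists_solution`). Bounded solutions are unique, since the initial time can be
sent to `-∞`. Stability is the case of equal forcings.

For unpredictability, split `σ = α + β`, let `ψ` be the bounded solution driven by `α` alone and `φ`
the one of the full system. The forcings differ by terms that vanish at `+∞`, hence so does `φ - ψ`.
Translating `ψ` by `q n * ω` gives a solution of the same system with `α` shifted by `q n`, so
convergence of the shifted sequence passes to `ψ`. Separation is local: on a gap between moments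
where the shifted and unshifted `α` differ by at least `υ`, the derivative of the difference of `ψ`
and its translate is a vector of that size plus a multiple of the difference, which therefore cannot
stay small. -/

/-! ### Counting moments and the evolution operator. -/

/-- The impulse moments with index greater than `k` that lie before `T`. -/
theorem RegularMoments.finite_lt {p : ℕ} {ω : ℝ} {θ : ℤ → ℝ} (hθ : θ ∈ RegularMoments p ω)
    (k : ℤ) (T : ℝ) : {j : ℤ | k < j ∧ θ j < T}.Finite := by
  obtain ⟨l, hl⟩ := RegularMoments.exists_mem_Ioc hθ T
  refine (finite_Icc k l).subset fun j hj => ⟨hj.1.le, ?_⟩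
  have := hθ.2.2.1.lt_iff_lt.mp (hj.2.trans_le hl.2)
  omega

/-- The count does not depend on `u` within a gap, so there the evolution operator is a smooth
exponential times a fixed power as a function of its initial time. -/
theorem countMoments_Ico_eq {θ : ℤ → ℝ} (hm : StrictMono θ) (T : ℝ) {k : ℤ} {u : ℝ}
    (hu : u ∈ Ioc (θ k) (θ (k + 1))) :
    countMoments θ (Ico u T) = {j : ℤ | k < j ∧ θ j < T}.ncard := by
  unfold countMoments
  congr 1
  ext j
  simp only [mem_ofPred_eq, mem_Ico, and_congr_left_iff]
  intro _
  constructor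
  · intro h
    exact hm.lt_iff_lt.mp (hu.1.trans_le h)
  · intro h
    exact hu.2.trans (hm.monotone (by omega))

theorem RegularMoments.ncard_lt_succ {p : ℕ} {ω : ℝ} {θ : ℤ → ℝ} (hθ : θ ∈ RegularMoments p ω)
    {k : ℤ} {T : ℝ} (hk : θ (k + 1) < T) :
    {j : ℤ | k < j ∧ θ j < T}.ncard = {j : ℤ | k + 1 < j ∧ θ j < T}.ncard + 1 := by
  have e : {j : ℤ | k < j ∧ θ j < T} = insert (k + 1) {j : ℤ | k + 1 < j ∧ θ j < T} := by
    ext j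
    simp only [mem_ofPred_eq, mem_insert_iff]
    constructor
    · rintro ⟨h1, h2⟩
      rcases eq_or_lt_of_le (Int.add_one_le_of_lt h1) with h | h
      · exact Or.inl h.symm
      · exact Or.inr ⟨h, h2⟩
    · rintro (rfl | ⟨h1, h2⟩)
      · exact ⟨by omega, hk⟩
      · exact ⟨by omega, h2⟩
  rw [e, ncard_insert_of_notMem (by simp) (RegularMoments.finite_lt hθ (k + 1) T)]

/-- The evolution operator of `x' = A x`, `Δx = B x`, for continuous linear maps. -/
noncomputable def evolution {E : Type*} [NormedAddCommGroup E] [NormedSpace ℝ E]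
    (A B : E →L[ℝ] E) (θ : ℤ → ℝ) (t s : ℝ) : E →L[ℝ] E :=
  NormedSpace.exp ((t - s) • A) * (1 + B) ^ countMoments θ (Ico s t)

theorem toEuclideanCLM_matriciant {m : ℕ} (A B : Matrix (Fin m) (Fin m) ℝ) (θ : ℤ → ℝ)
    (t s : ℝ) : Matrix.toEuclideanCLM (𝕜 := ℝ) (matriciant A B θ t s) =
      evolution (Matrix.toEuclideanCLM (𝕜 := ℝ) A) (Matrix.toEuclideanCLM (𝕜 := ℝ) B) θ t s := by
  have hc : Continuous (Matrix.toEuclideanCLM (n := Fin m) (𝕜 := ℝ)) :=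
    (AddMonoidHomClass.isometry_of_norm _ Matrix.l2_opNorm_toEuclideanCLM).continuous
  let : NormedAlgebra ℚ (Matrix (Fin m) (Fin m) ℝ) := NormedAlgebra.restrictScalars ℚ ℝ _
  let : NormedAlgebra ℚ (EuclideanSpace ℝ (Fin m) →L[ℝ] EuclideanSpace ℝ (Fin m)) :=
    NormedAlgebra.restrictScalars ℚ ℝ _
  have := NormedSpace.map_exp (Matrix.toEuclideanCLM (n := Fin m) (𝕜 := ℝ)) hc ((t - s) • A)
  simp only [matriciant, evolution, map_mul, map_pow, map_add, map_one, this, map_smul]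

/-! ### Variation of constants for the linear impulsive system. -/

section

variable {m p : ℕ} {ω : ℝ} {θ : ℤ → ℝ}

local notation "E" => EuclideanSpace ℝ (Fin m)

theorem IsImpulsiveSolution.continuousWithinAt_Iic {F : ℝ → E → E} {G : ℤ → E → E} {J : Set ℝ}
    {x : ℝ → E} (hx : IsImpulsiveSolution θ F G J x) {t : ℝ} (ht : t ∈ J) :
    ContinuousWithinAt x (J ∩ Iic t) t := by
  by_cases h : t ∈ range θ
  · obtain ⟨k, rfl⟩ := h
    have h1 : ContinuousWithinAt x (J ∩ Iio (θ k)) (θ k) := hx.2.1 k ht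
    refine (continuousWithinAt_insert_self.mpr h1).mono ?_
    rintro u ⟨h2, h3⟩
    rcases eq_or_lt_of_le (show u ≤ θ k from h3) with h4 | h4
    · exact Or.inl h4
    · exact Or.inr ⟨h2, h4⟩
  · exact (hx.1 t ht h).continuousWithinAt.mono inter_subset_left

theorem RegularMoments.notMem_range (hθ : θ ∈ RegularMoments p ω) {k : ℤ} {t : ℝ}
    (ht : t ∈ Ioo (θ k) (θ (k + 1))) : t ∉ range θ := by
  rintro ⟨j, rfl⟩
  have h1 := hθ.2.2.1.lt_iff_lt.mp ht.1
  have h2 := hθ.2.2.1.lt_iff_lt.mp ht.2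
  omega

theorem IsImpulsiveSolution.continuousOn_Icc (hθ : θ ∈ RegularMoments p ω)
    {F : ℝ → E → E} {G : ℤ → E → E} {s : ℝ}
    {x : ℝ → E} (hx : IsImpulsiveSolution θ F G (Ici s) x) {k : ℤ} {a b : ℝ} (hs : s ≤ a)
    (ha : θ k < a) (hb : b ≤ θ (k + 1)) : ContinuousOn x (Icc a b) := by
  intro u hu
  rcases eq_or_lt_of_le hu.2 with h | h
  · subst h
    exact (hx.continuousWithinAt_Iic (hs.trans hu.1)).mono fun v hv => ⟨hs.trans hv.1, hv.2⟩
  · exact (hx.1 u (hs.trans hu.1) (RegularMoments.notMem_range hθ ⟨ha.trans_le hu.1, h.trans_le hb⟩)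
      ).continuousWithinAt.mono fun v hv => hs.trans hv.1

/-- Between consecutive impulse moments, `‖U(T, u) w(u)‖` grows no faster than the inhomogeneity
permits. -/
theorem norm_exp_mul_pow_apply_le (hθ : θ ∈ RegularMoments p ω) {A B : E →L[ℝ] E}
    (hAB : Commute A B) {N lam : ℝ} {s T : ℝ} {w w' : ℝ → E} {d : ℤ → E}
    (hw : IsImpulsiveSolution θ (fun t _ => w' t) (fun k _ => d k) (Ici s) w)
    {k : ℤ} {c : ℕ} {a b : ℝ}
    (hU : ∀ u ∈ Icc a b, ‖NormedSpace.exp ((T - u) • A) * (1 + B) ^ c‖ ≤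
      N * Real.exp (-lam * (T - u)))
    {β β' : ℝ → ℝ} (hβ : ∀ u, HasDerivAt β (β' u) u)
    (hr : ∀ u ∈ Ico a b, N * Real.exp (-lam * (T - u)) * ‖w' u - A (w u)‖ ≤ β' u)
    (hs : s ≤ a) (ha : θ k < a) (hab : a ≤ b) (hb : b ≤ θ (k + 1)) :
    ‖(NormedSpace.exp ((T - b) • A) * (1 + B) ^ c) (w b)‖ ≤
      ‖(NormedSpace.exp ((T - a) • A) * (1 + B) ^ c) (w a)‖ + (β b - β a) := by
  -- Commutation lets `A` stand on the right; it then cancels the linear part of `w'`, so only `w' u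
  -- - A (w u)` contributes.
  have hexp : ∀ u : ℝ, HasDerivAt (fun u : ℝ => NormedSpace.exp ((T - u) • A) * (1 + B) ^ c)
      (-(NormedSpace.exp ((T - u) • A) * (1 + B) ^ c * A)) u := by
    intro u
    have h1 : HasDerivAt (fun v : ℝ => NormedSpace.exp (v • A))
        (NormedSpace.exp ((T - u) • A) * A) (T - u) := hasDerivAt_exp_smul_const A (T - u)
    have h2 := (h1.scomp u ((hasDerivAt_id u).const_sub T)).mul_const ((1 + B) ^ c)
    refine h2.congr_deriv ?_
    have h3 : Commute A ((1 + B) ^ c) := ((Commute.one_right A).add_right hAB).pow_right c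
    rw [mul_assoc _ _ A, ← h3.eq, ← mul_assoc, neg_one_smul]
    exact neg_mul (NormedSpace.exp ((T - u) • A) * A) ((1 + B) ^ c)
  have hcont := hw.continuousOn_Icc hθ hs ha hb
  have key := image_norm_le_of_norm_deriv_right_le_deriv_boundary (a := a) (b := b)
    (f := fun u => (NormedSpace.exp ((T - u) • A) * (1 + B) ^ c) (w u))
    (f' := fun u => (NormedSpace.exp ((T - u) • A) * (1 + B) ^ c) (w' u - A (w u)))
    (B := fun u => ‖(NormedSpace.exp ((T - a) • A) * (1 + B) ^ c) (w a)‖ + (β u - β a))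
    (B' := β') ?_ ?_ (by simp) (fun u => ((hβ u).sub_const _).const_add _) ?_
  · exact key ⟨hab, le_rfl⟩
  · exact ContinuousOn.clm_apply (fun u _ => (hexp u).continuousAt.continuousWithinAt) hcont
  · intro u hu
    have h1 := (hw.1 u (hs.trans hu.1) (RegularMoments.notMem_range hθ ⟨ha.trans_le hu.1, hu.2.trans_le hb⟩)
      ).mono (Ici_subset_Ici.mpr (hs.trans hu.1))
    refine ((hexp u).hasDerivWithinAt.clm_apply h1).congr_deriv ?_
    rw [map_sub, neg_apply]
    exact (sub_eq_neg_add _ _).symm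
  · intro u hu
    refine (ContinuousLinearMap.le_opNorm _ _).trans (le_trans ?_ (hr u hu))
    exact mul_le_mul_of_nonneg_right (hU u ⟨hu.1, hu.2.le⟩) (norm_nonneg _)

end

/-- Induction by whole periods: the last `p` terms are at most `1` each, and the earlier ones are
the same sum for `T - ω` scaled by `exp (-μ * ω)`. The bound is the fixed point of `y = exp (-μ * ω)
* y + p`. -/
theorem RegularMoments.sum_exp_le {p : ℕ} {ω : ℝ} {θ : ℤ → ℝ} (hθ : θ ∈ RegularMoments p ω)
    {μ : ℝ} (hμ : 0 < μ) (j : ℤ) (n : ℕ) :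
    ∀ T : ℝ, θ (j + n) ≤ T → ∑ i ∈ Finset.range n, Real.exp (-μ * (T - θ (j + 1 + i))) ≤
      p / (1 - Real.exp (-μ * ω)) := by
  have hx0 := Real.exp_pos (-μ * ω)
  have hx1 : Real.exp (-μ * ω) < 1 := by
    rw [Real.exp_lt_one_iff]
    nlinarith [hθ.2.1, mul_pos hμ hθ.2.1]
  have hterm : ∀ (n : ℕ) (T : ℝ), θ (j + n) ≤ T → ∀ i < n,
      Real.exp (-μ * (T - θ (j + 1 + i))) ≤ 1 := by
    intro n T hT i hi
    rw [Real.exp_le_one_iff]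
    have : θ (j + 1 + i) ≤ θ (j + n) := hθ.2.2.1.monotone (by omega)
    nlinarith
  have hp : (p : ℝ) ≤ p / (1 - Real.exp (-μ * ω)) := by
    rw [le_div_iff₀ (by linarith)]
    nlinarith [(Nat.cast_nonneg p : (0 : ℝ) ≤ p)]
  induction n using Nat.strong_induction_on with
  | _ n ih =>
    intro T hT
    rcases lt_or_ge n p with h | h
    · refine le_trans (Finset.sum_le_card_nsmul _ _ 1 fun i hi =>
        hterm n T hT i (Finset.mem_range.mp hi)) ?_
      simp only [Finset.card_range, nsmul_eq_mul, mul_one]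
      exact le_trans (by exact_mod_cast h.le) hp
    · obtain ⟨l, rfl⟩ := Nat.exists_eq_add_of_le' h
      have hT' : θ (j + l) ≤ T - ω := by
        have := hθ.2.2.2 (j + l)
        push_cast at hT
        rw [← add_assoc] at hT
        linarith
      have h1 := ih l (by have := hθ.1; omega) (T - ω) hT'
      rw [Finset.sum_range_add]
      have h2 : ∑ i ∈ Finset.range l, Real.exp (-μ * (T - θ (j + 1 + i))) =
          Real.exp (-μ * ω) *
            ∑ i ∈ Finset.range l, Real.exp (-μ * (T - ω - θ (j + 1 + i))) := by
        rw [Finset.mul_sum]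
        refine Finset.sum_congr rfl fun i _ => ?_
        rw [← Real.exp_add]
        ring_nf
      have h3 : ∑ i ∈ Finset.range p, Real.exp (-μ * (T - θ (j + 1 + (l + i : ℕ)))) ≤ p := by
        refine le_trans (Finset.sum_le_card_nsmul _ _ 1 fun i hi =>
          hterm (l + p) T hT (l + i) (by have := Finset.mem_range.mp hi; omega)) ?_
        simp
      rw [h2]
      have h4 : (p : ℝ) / (1 - Real.exp (-μ * ω)) =
          Real.exp (-μ * ω) * (p / (1 - Real.exp (-μ * ω))) + p := by
        have h5 : 1 - Real.exp (-μ * ω) ≠ 0 := by linarith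
        generalize Real.exp (-μ * ω) = y at h5
        field_simp
        ring
      rw [h4]
      exact add_le_add (mul_le_mul_of_nonneg_left h1 hx0.le) h3

section

variable {m p : ℕ} {ω : ℝ} {θ : ℤ → ℝ}

local notation "E" => EuclideanSpace ℝ (Fin m)

theorem RegularMoments.evolution_eq (hθ : θ ∈ RegularMoments p ω) (A B : E →L[ℝ] E) {k : ℤ}
    {T u : ℝ} (hu : u ∈ Ioc (θ k) (θ (k + 1))) : evolution A B θ T u =
      NormedSpace.exp ((T - u) • A) * (1 + B) ^ {j : ℤ | k < j ∧ θ j < T}.ncard := by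
  rw [evolution, countMoments_Ico_eq hθ.2.2.1 T hu]

theorem continuous_exp_sub_smul_mul (A M : E →L[ℝ] E) (T : ℝ) :
    Continuous fun u : ℝ => NormedSpace.exp ((T - u) • A) * M := by
  let _ : NormedAlgebra ℚ (E →L[ℝ] E) := NormedAlgebra.restrictScalars ℚ ℝ _
  exact (NormedSpace.exp_continuous.comp
    ((continuous_const.sub continuous_id).smul continuous_const)).mul continuous_const

theorem tendsto_clm_apply {f : ℝ → E →L[ℝ] E} (hf : Continuous f) {w : ℝ → E} {b : ℝ} {l : E}
    {S : Set ℝ} (hw : Tendsto w (𝓝[S] b) (𝓝 l)) :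
    Tendsto (fun a => f a (w a)) (𝓝[S] b) (𝓝 (f b l)) :=
  (isBoundedBilinearMap_apply.continuous.tendsto (f b, l)).comp
    (((hf.tendsto b).mono_left nhdsWithin_le_nhds).prodMk_nhds hw)

/-- The operator here is the right limit of `evolution A B θ T` at `θ k`. It lacks the factor `1 +
B` present in the value at `θ k`, so `hU` is used just to the right and passed to the limit. -/
theorem RegularMoments.norm_exp_mul_pow_le (hθ : θ ∈ RegularMoments p ω) {A B : E →L[ℝ] E}
    {N lam : ℝ}
    (hU : ∀ t s : ℝ, s ≤ t → ‖evolution A B θ t s‖ ≤ N * Real.exp (-lam * (t - s)))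
    {k : ℤ} {T : ℝ} (hT : θ k < T) :
    ‖NormedSpace.exp ((T - θ k) • A) * (1 + B) ^ {j : ℤ | k < j ∧ θ j < T}.ncard‖ ≤
      N * Real.exp (-lam * (T - θ k)) := by
  have h1 := ((continuous_exp_sub_smul_mul A
    ((1 + B) ^ {j : ℤ | k < j ∧ θ j < T}.ncard) T).norm.tendsto (θ k)).mono_left
      (nhdsWithin_le_nhds (s := Ioi (θ k)))
  have h2 : Tendsto (fun u => N * Real.exp (-lam * (T - u))) (𝓝[>] θ k)
      (𝓝 (N * Real.exp (-lam * (T - θ k)))) :=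
    ((by fun_prop : Continuous fun u => N * Real.exp (-lam * (T - u))).tendsto _).mono_left
      nhdsWithin_le_nhds
  refine le_of_tendsto_of_tendsto h1 h2 ?_
  have hk : θ k < θ (k + 1) := hθ.2.2.1 (by omega)
  filter_upwards [Ioo_mem_nhdsGT hT, Ioo_mem_nhdsGT hk] with u hu hu'
  rw [← RegularMoments.evolution_eq hθ A B ⟨hu'.1, hu'.2.le⟩]
  exact hU _ _ hu.2.le

/-- The estimate that the variation of constants formula gives for a solution of the linear
impulsive system with inhomogeneities bounded by exponentials. -/
theorem IsImpulsiveSolution.norm_le (hθ : θ ∈ RegularMoments p ω) {A B : E →L[ℝ] E}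
    (hAB : Commute A B) {N lam : ℝ}
    (hU : ∀ t s : ℝ, s ≤ t → ‖evolution A B θ t s‖ ≤ N * Real.exp (-lam * (t - s)))
    {s T : ℝ} (hsT : s ≤ T) {w w' : ℝ → E} {d : ℤ → E}
    (hw : IsImpulsiveSolution θ (fun t _ => w' t) (fun k _ => d k) (Ici s) w)
    {μ R₁ R₂ : ℝ} (hμ : 0 < μ) (hR₁ : 0 ≤ R₁) (hR₂ : 0 ≤ R₂)
    (h₁ : ∀ u ∈ Ico s T, u ∉ range θ →
      N * Real.exp (-lam * (T - u)) * ‖w' u - A (w u)‖ ≤ R₁ * Real.exp (-μ * (T - u)))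
    (h₂ : ∀ k, θ k ∈ Ico s T → N * Real.exp (-lam * (T - θ k)) * ‖d k - B (w (θ k))‖ ≤
      R₂ * Real.exp (-μ * (T - θ k))) :
    ‖w T‖ ≤ N * Real.exp (-lam * (T - s)) * ‖w s‖ + R₁ / μ +
      R₂ * (p / (1 - Real.exp (-μ * ω))) := by
  obtain ⟨j, hj⟩ := RegularMoments.exists_mem_Ioc hθ s
  have hm := hθ.2.2.1
  set β : ℝ → ℝ := fun u => R₁ / μ * Real.exp (-μ * (T - u)) with hβ
  have hβ' : ∀ u, HasDerivAt β (R₁ * Real.exp (-μ * (T - u))) u := by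
    intro u
    have h := ((((hasDerivAt_id u).const_sub T).const_mul (-μ)).exp).const_mul (R₁ / μ)
    refine h.congr_deriv ?_
    simp only [id]
    field_simp
  -- For fixed `T`, follow `u ↦ U(T, u) w(u)` from `s`, by induction on the number `n` of moments
  -- crossed. At `u = T` it equals `w T`.
  have claim : ∀ n : ℕ, ∀ u ∈ Ioc (θ (j + n)) (θ (j + n + 1)), s ≤ u → u ≤ T →
      ‖evolution A B θ T u (w u)‖ ≤ ‖evolution A B θ T s (w s)‖ + (β u - β s) +
        ∑ i ∈ Finset.range n, R₂ * Real.exp (-μ * (T - θ (j + 1 + i))) := by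
    intro n
    induction n with
    | zero =>
      intro u hu hsu huT
      simp only [Nat.cast_zero, add_zero] at hu
      rw [RegularMoments.evolution_eq hθ A B hu, RegularMoments.evolution_eq hθ A B hj,
        Finset.range_zero, Finset.sum_empty, add_zero]
      refine norm_exp_mul_pow_apply_le (N := N) (lam := lam) hθ hAB hw ?_ hβ' ?_ le_rfl hj.1 hsu hu.2
      · intro v hv
        rw [← RegularMoments.evolution_eq hθ A B ⟨hj.1.trans_le hv.1, hv.2.trans hu.2⟩]
        exact hU _ _ (hv.2.trans huT)
      · intro v hv
        exact h₁ v ⟨hv.1, hv.2.trans_le huT⟩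
          (RegularMoments.notMem_range hθ ⟨hj.1.trans_le hv.1, hv.2.trans_le hu.2⟩)
    | succ n ih =>
      intro u hu hsu huT
      set K : ℤ := j + n with hK
      have hK1 : j + ((n + 1 : ℕ) : ℤ) = K + 1 := by push_cast; ring
      rw [hK1] at hu
      have hsb : s ≤ θ (K + 1) := hj.2.trans (hm.monotone (by omega))
      have hbT : θ (K + 1) < T := hu.1.trans_le huT
      have hb := ih (θ (K + 1)) ⟨hm (by omega), le_rfl⟩ hsb hbT.le
      set c := {j : ℤ | K + 1 < j ∧ θ j < T}.ncard with hc
      have hstep : ∀ a ∈ Ioc (θ (K + 1)) u,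
          ‖(NormedSpace.exp ((T - u) • A) * (1 + B) ^ c) (w u)‖ ≤
            ‖(NormedSpace.exp ((T - a) • A) * (1 + B) ^ c) (w a)‖ + (β u - β a) := by
        intro a ha
        refine norm_exp_mul_pow_apply_le (N := N) (lam := lam) hθ hAB hw ?_ hβ' ?_ (hsb.trans ha.1.le) ha.1 ha.2 hu.2
        · intro v hv
          rw [← RegularMoments.evolution_eq hθ A B ⟨ha.1.trans_le hv.1, hv.2.trans hu.2⟩]
          exact hU _ _ (hv.2.trans huT)
        · intro v hv
          exact h₁ v ⟨(hsb.trans ha.1.le).trans hv.1, hv.2.trans_le huT⟩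
            (RegularMoments.notMem_range hθ ⟨ha.1.trans_le hv.1, hv.2.trans_le hu.2⟩)
      have hwl : Tendsto w (𝓝[>] θ (K + 1)) (𝓝 (w (θ (K + 1)) + d (K + 1))) := by
        have := hw.2.2 (K + 1) hsb
        rwa [inter_eq_right.mpr (Ioi_subset_Ici hsb)] at this
      set Z : E →L[ℝ] E := NormedSpace.exp ((T - θ (K + 1)) • A) * (1 + B) ^ c with hZ
      -- `w` is only left-continuous at the moment, so the gap estimate holds for `a` strictly to
      -- its right, and `a` is then sent to it.
      have hlim : Tendsto (fun a => ‖(NormedSpace.exp ((T - a) • A) * (1 + B) ^ c) (w a)‖ +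
          (β u - β a)) (𝓝[>] θ (K + 1))
          (𝓝 (‖Z (w (θ (K + 1)) + d (K + 1))‖ + (β u - β (θ (K + 1))))) := by
        refine Tendsto.add (Tendsto.norm ?_) ?_
        · exact tendsto_clm_apply (continuous_exp_sub_smul_mul A ((1 + B) ^ c) T) hwl
        · exact ((hβ' _).continuousAt.tendsto.mono_left nhdsWithin_le_nhds).const_sub _
      have h3 := ge_of_tendsto hlim (by
        filter_upwards [Ioc_mem_nhdsGT hu.1] with a ha using hstep a ha)
      -- Crossing the moment absorbs the linear jump in the factor `1 + B` of the evolution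
      -- operator; only `d - B w` is left over.
      have h4 : Z (w (θ (K + 1)) + d (K + 1)) = evolution A B θ T (θ (K + 1)) (w (θ (K + 1))) +
          Z (d (K + 1) - B (w (θ (K + 1)))) := by
        rw [RegularMoments.evolution_eq hθ A B (k := K) ⟨hm (by omega), le_rfl⟩,
          RegularMoments.ncard_lt_succ hθ hbT, pow_succ, ← mul_assoc]
        change _ = Z ((1 + B) (w (θ (K + 1)))) + _
        rw [← map_add]
        congr 1
        change _ = w (θ (K + 1)) + B (w (θ (K + 1))) + _
        abel
      have h5 : ‖Z (d (K + 1) - B (w (θ (K + 1))))‖ ≤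
          R₂ * Real.exp (-μ * (T - θ (K + 1))) := by
        refine (Z.le_opNorm _).trans (le_trans ?_ (h₂ (K + 1) ⟨hsb, hbT⟩))
        exact mul_le_mul_of_nonneg_right (RegularMoments.norm_exp_mul_pow_le hθ hU hbT)
          (norm_nonneg _)
      have h6 : j + 1 + (n : ℤ) = K + 1 := by omega
      rw [RegularMoments.evolution_eq hθ A B hu, Finset.sum_range_succ, h6]
      rw [h4] at h3
      have h7 := norm_add_le (evolution A B θ T (θ (K + 1)) (w (θ (K + 1))))
        (Z (d (K + 1) - B (w (θ (K + 1)))))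
      linarith
  obtain ⟨k, hk⟩ := RegularMoments.exists_mem_Ioc hθ T
  have hjk : j ≤ k := by
    have := hm.lt_iff_lt.mp (hj.1.trans_le (hsT.trans hk.2))
    omega
  obtain ⟨n, hn⟩ := Int.le.dest hjk
  subst hn
  have h3 := claim n T hk hsT le_rfl
  rw [← Finset.mul_sum] at h3
  have h4 := mul_le_mul_of_nonneg_left (RegularMoments.sum_exp_le hθ hμ j n T hk.1.le) hR₂
  have h5 : evolution A B θ T T = 1 := by simp [evolution, countMoments]
  have h6 : ‖evolution A B θ T s (w s)‖ ≤ N * Real.exp (-lam * (T - s)) * ‖w s‖ :=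
    (ContinuousLinearMap.le_opNorm _ _).trans
      (mul_le_mul_of_nonneg_right (hU _ _ hsT) (norm_nonneg _))
  have h7 : β T - β s ≤ R₁ / μ := by
    have : 0 ≤ β s := by positivity
    have : β T = R₁ / μ := by simp [hβ]
    linarith
  rw [h5] at h3
  change ‖w T‖ ≤ _ at h3
  linarith

/-! ### Exponential decay under small Lipschitz perturbations. -/

/-- One-sided limits exist everywhere, so a solution is locally bounded, and compactness finishes.
This a priori bound starts the iteration in `exists_perturbationBound`. -/
theorem IsImpulsiveSolution.exists_norm_le {F : ℝ → E → E} {G : ℤ → E → E} {s : ℝ} {x : ℝ → E}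
    (hx : IsImpulsiveSolution θ F G (Ici s) x) (T : ℝ) :
    ∃ M, ∀ u ∈ Icc s T, ‖x u‖ ≤ M := by
  refine isCompact_Icc.induction_on (p := fun S => ∃ M, ∀ u ∈ S, ‖x u‖ ≤ M) ⟨0, by simp⟩
    (fun S₁ S₂ h ⟨M, hM⟩ => ⟨M, fun u hu => hM u (h hu)⟩) ?_ ?_
  · rintro S₁ S₂ ⟨M₁, h₁⟩ ⟨M₂, h₂⟩
    refine ⟨max M₁ M₂, fun u hu => ?_⟩
    rcases hu with hu | hu
    · exact (h₁ u hu).trans (le_max_left _ _)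
    · exact (h₂ u hu).trans (le_max_right _ _)
  · intro u hu
    have hl := (hx.continuousWithinAt_Iic (t := u) hu.1).norm.eventually_le_const
      (lt_add_one ‖x u‖)
    have hr : ∃ l, Tendsto x (𝓝[Ici s ∩ Ioi u] u) (𝓝 l) := by
      by_cases h : u ∈ range θ
      · obtain ⟨k, rfl⟩ := h
        exact ⟨_, hx.2.2 k hu.1⟩
      · exact ⟨_, (hx.1 u hu.1 h).continuousWithinAt.mono_left
          (nhdsWithin_mono _ inter_subset_left)⟩
    obtain ⟨l, hl'⟩ := hr
    have hr := hl'.norm.eventually_le_const (lt_add_one ‖l‖)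
    have hle : 𝓝[Icc s T] u ≤ 𝓝[Ici s ∩ Iic u] u ⊔ 𝓝[Ici s ∩ Ioi u] u := by
      rw [← nhdsWithin_union, ← inter_union_distrib_left, Iic_union_Ioi, inter_univ]
      exact nhdsWithin_mono _ Icc_subset_Ici_self
    refine ⟨{v | ‖x v‖ ≤ max (‖x u‖ + 1) (‖l‖ + 1)}, hle (mem_sup.mpr ⟨?_, ?_⟩), _,
      fun v hv => hv⟩
    · filter_upwards [hl] with v hv using hv.trans (le_max_left _ _)
    · filter_upwards [hr] with v hv using hv.trans (le_max_right _ _)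

/-- The condition is strict and continuous in `κ` at `0`, so a little of the decay rate can be given
up. -/
theorem exists_pos_rate {N lam Lf Lh ω : ℝ} {p : ℕ} (hlam : 0 < lam) (hω : 0 < ω)
    (hq : N * (Lf / lam + p * Lh / (1 - Real.exp (-lam * ω))) < 1) :
    ∃ κ, 0 < κ ∧ κ < lam ∧
      N * (Lf / (lam - κ) + p * Lh / (1 - Real.exp (-(lam - κ) * ω))) < 1 := by
  have hx1 : Real.exp (-lam * ω) < 1 := by
    rw [Real.exp_lt_one_iff]
    nlinarith [mul_pos hlam hω]
  have hc : ContinuousAt (fun κ : ℝ =>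
      N * (Lf / (lam - κ) + p * Lh / (1 - Real.exp (-(lam - κ) * ω)))) 0 := by
    refine continuousAt_const.mul (.add (.div continuousAt_const (by fun_prop) ?_)
      (.div continuousAt_const (by fun_prop) ?_))
    · simpa using hlam.ne'
    · simp only [sub_zero]
      linarith
  have h1 := hc.eventually_lt_const (u := 1) (by simpa using hq)
  obtain ⟨κ, h2, h3⟩ := ((h1.filter_mono nhdsWithin_le_nhds).and
    (Ioo_mem_nhdsGT hlam : ∀ᶠ κ in 𝓝[>] (0 : ℝ), κ ∈ Ioo 0 lam)).exists
  exact ⟨κ, h3.1, h3.2, h2⟩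

/-- Solutions of `w' = A w + r`, `Δw = B w + d` with inhomogeneities `r`, `d` that are, up to an
error `ε`, Lipschitz small in `w` decay with rate `κ`, up to a multiple of the error. -/
def PerturbationBound (θ : ℤ → ℝ) (A B : E →L[ℝ] E) (Lf Lh C κ : ℝ) : Prop :=
  ∀ (s T : ℝ) (w w' : ℝ → E) (d : ℤ → E) (ε δ : ℝ),
    IsImpulsiveSolution θ (fun t _ => w' t) (fun k _ => d k) (Ici s) w →
    0 ≤ ε → 0 < δ → ‖w s‖ ≤ δ →
    (∀ u ∈ Ico s T, u ∉ range θ → ‖w' u - A (w u)‖ ≤ Lf * ‖w u‖ + ε) →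
    (∀ k, θ k ∈ Ico s T → ‖d k - B (w (θ k))‖ ≤ Lh * ‖w (θ k)‖ + ε) →
    ∀ t ∈ Icc s T, ‖w t‖ ≤ C * (δ * Real.exp (-κ * (t - s)) + ε)

/-- A linear impulsive system whose evolution operator decays exponentially, subject to a small
Lipschitz perturbation: solutions decay up to the size of the inhomogeneity. -/
theorem exists_perturbationBound (hθ : θ ∈ RegularMoments p ω) {A B : E →L[ℝ] E}
    (hAB : Commute A B) {N lam : ℝ} (hN : 1 ≤ N) (hlam : 0 < lam)
    (hU : ∀ t s : ℝ, s ≤ t → ‖evolution A B θ t s‖ ≤ N * Real.exp (-lam * (t - s)))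
    {Lf Lh : ℝ} (hLf : 0 ≤ Lf) (hLh : 0 ≤ Lh)
    (hq : N * (Lf / lam + p * Lh / (1 - Real.exp (-lam * ω))) < 1) :
    ∃ C κ : ℝ, 0 < C ∧ 0 < κ ∧ PerturbationBound θ A B Lf Lh C κ := by
  obtain ⟨κ, hκ, hκl, hq⟩ := exists_pos_rate hlam hθ.2.1 hq
  have hμ : 0 < lam - κ := sub_pos.mpr hκl
  set μ := lam - κ with hμdef
  have hx1 : Real.exp (-μ * ω) < 1 := by
    rw [Real.exp_lt_one_iff]
    nlinarith [mul_pos hμ hθ.2.1]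
  set y : ℝ := p / (1 - Real.exp (-μ * ω)) with hy
  have hy0 : 0 ≤ y := div_nonneg (Nat.cast_nonneg _) (by linarith)
  set q : ℝ := N * (Lf / μ + p * Lh / (1 - Real.exp (-μ * ω))) with hqdef
  have hqe : q = N * Lf / μ + N * Lh * y := by rw [hqdef, hy]; ring
  have hN0 : 0 < N := by linarith
  have hq0 : 0 ≤ q := by rw [hqe]; positivity
  -- The summand `N` pays for the initial value; `N / μ` and `N * y` pay for the error `ε`, in the
  -- flow and in the impulses.
  set c : ℝ := N + N / μ + N * y with hc
  have hc0 : 0 < c := by positivity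
  refine ⟨c / (1 - q), κ, div_pos hc0 (by linarith), hκ, ?_⟩
  intro s T w w' d ε δ hw hε hδ hws h₁ h₂ t₀ ht₀
  set ρ : ℝ → ℝ := fun u => δ * Real.exp (-κ * (u - s)) + ε with hρ
  have hρ0 : ∀ u, 0 < ρ u := fun u => by positivity
  have hρε : ∀ u, ε ≤ ρ u := fun u => le_add_of_nonneg_left (by positivity)
  have hexp : ∀ u t, u ≤ t →
      Real.exp (-lam * (t - u)) * ρ u ≤ ρ t * Real.exp (-μ * (t - u)) := by
    intro u t hut
    have e1 : Real.exp (-lam * (t - u)) = Real.exp (-κ * (t - u)) * Real.exp (-μ * (t - u)) := by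
      rw [← Real.exp_add, hμdef]
      ring_nf
    have e2 : Real.exp (-κ * (t - u)) * ρ u ≤ ρ t := by
      simp only [hρ, mul_add]
      refine add_le_add (le_of_eq ?_) ?_
      · rw [mul_left_comm, ← Real.exp_add]
        ring_nf
      · refine mul_le_of_le_one_left hε ?_
        rw [Real.exp_le_one_iff]
        nlinarith
    calc _ = Real.exp (-κ * (t - u)) * ρ u * Real.exp (-μ * (t - u)) := by rw [e1]; ring
      _ ≤ _ := mul_le_mul_of_nonneg_right e2 (Real.exp_pos _).le
  -- A bound relative to the weight `ρ` improves itself through variation of constants. The rate `κ`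
  -- is spent on comparing `ρ u` with `ρ t`; the remaining `μ = lam - κ` makes the integral and the
  -- sum converge.
  have himp : ∀ M, 0 ≤ M → (∀ u ∈ Icc s T, ‖w u‖ ≤ M * ρ u) →
      ∀ t ∈ Icc s T, ‖w t‖ ≤ (c + q * M) * ρ t := by
    intro M hM hwM t ht
    have hbound : ∀ (L : ℝ), 0 ≤ L → ∀ (u r : ℝ), u ∈ Ico s t → r ≤ L * ‖w u‖ + ε →
        N * Real.exp (-lam * (t - u)) * r ≤ N * (L * M + 1) * ρ t * Real.exp (-μ * (t - u)) := by
      intro L hL u r hu hr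
      have h3 : r ≤ (L * M + 1) * ρ u := by
        have := mul_le_mul_of_nonneg_left (hwM u ⟨hu.1, hu.2.le.trans ht.2⟩) hL
        have := hρε u
        linarith
      calc N * Real.exp (-lam * (t - u)) * r
          ≤ N * Real.exp (-lam * (t - u)) * ((L * M + 1) * ρ u) := by gcongr
        _ = N * (L * M + 1) * (Real.exp (-lam * (t - u)) * ρ u) := by ring
        _ ≤ N * (L * M + 1) * (ρ t * Real.exp (-μ * (t - u))) := by
            gcongr N * (L * M + 1) * ?_
            exact hexp u t hu.2.le
        _ = _ := by ring
    have h3 := hw.norm_le hθ hAB hU ht.1 (μ := μ) (R₁ := N * (Lf * M + 1) * ρ t)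
      (R₂ := N * (Lh * M + 1) * ρ t) hμ (by have := hρ0 t; positivity)
      (by have := hρ0 t; positivity)
      (fun u hu hur => hbound Lf hLf u _ hu (h₁ u ⟨hu.1, hu.2.trans_le ht.2⟩ hur))
      (fun k hk => hbound Lh hLh _ _ hk (h₂ k ⟨hk.1, hk.2.trans_le ht.2⟩))
    have h4 : N * Real.exp (-lam * (t - s)) * ‖w s‖ ≤ N * ρ t := by
      rw [mul_assoc]
      refine mul_le_mul_of_nonneg_left ?_ hN0.le
      have h5 : Real.exp (-lam * (t - s)) ≤ Real.exp (-κ * (t - s)) := by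
        rw [Real.exp_le_exp]
        nlinarith [ht.1]
      calc Real.exp (-lam * (t - s)) * ‖w s‖ ≤ Real.exp (-κ * (t - s)) * δ :=
            mul_le_mul h5 hws (norm_nonneg _) (Real.exp_pos _).le
        _ ≤ ρ t := by simp only [hρ]; linarith
    have h5 : (c + q * M) * ρ t = N * ρ t + N * (Lf * M + 1) * ρ t / μ +
        N * (Lh * M + 1) * ρ t * y := by
      rw [hqe, hc]
      ring
    linarith
  obtain ⟨M₀, hM₀⟩ := hw.exists_norm_le T
  have hρT : ∀ u ∈ Icc s T, ρ T ≤ ρ u := by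
    intro u hu
    simp only [hρ]
    gcongr δ * Real.exp ?_ + ε
    nlinarith [hu.2]
  -- The map `M ↦ c + q * M` has fixed point `c / (1 - q)`. As `ρ` is nonincreasing, dividing the a
  -- priori bound by `ρ T` gives a valid start; its contribution dies out with `q ^ n`.
  have hiter : ∀ n : ℕ, ∀ u ∈ Icc s T,
      ‖w u‖ ≤ (q ^ n * (max M₀ 0 / ρ T) + c / (1 - q)) * ρ u := by
    have hM : 0 ≤ max M₀ 0 / ρ T := div_nonneg (le_max_right _ _) (hρ0 T).le
    have hC : 0 ≤ c / (1 - q) := div_nonneg hc0.le (by linarith)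
    intro n
    induction n with
    | zero =>
      intro u hu
      have h3 : max M₀ 0 / ρ T * ρ T ≤ max M₀ 0 / ρ T * ρ u :=
        mul_le_mul_of_nonneg_left (hρT u hu) hM
      rw [div_mul_cancel₀ _ (hρ0 T).ne'] at h3
      have h4 := mul_nonneg hC (hρ0 u).le
      have h5 := (hM₀ u hu).trans (le_max_left M₀ 0)
      rw [pow_zero, one_mul, add_mul]
      linarith
    | succ n ih =>
      intro u hu
      refine (himp _ (by positivity) ih u hu).trans (le_of_eq ?_)
      congr 1
      have : 1 - q ≠ 0 := by linarith
      field_simp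
      ring
  have hlim : Tendsto (fun n : ℕ => (q ^ n * (max M₀ 0 / ρ T) + c / (1 - q)) * ρ t₀) atTop
      (𝓝 ((0 * (max M₀ 0 / ρ T) + c / (1 - q)) * ρ t₀)) :=
    (((tendsto_pow_atTop_nhds_zero_of_lt_one hq0 hq).mul_const _).add_const _).mul_const _
  have := ge_of_tendsto' hlim fun n => hiter n t₀ ht₀
  rwa [zero_mul, zero_add] at this

/-! ### Differences, restrictions and translates of solutions. -/

/-- The right-hand sides are frozen along the two solutions, which is the form `PerturbationBound`
accepts. -/
theorem IsImpulsiveSolution.sub {F₁ F₂ : ℝ → E → E} {G₁ G₂ : ℤ → E → E} {J : Set ℝ}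
    {x y : ℝ → E} (hx : IsImpulsiveSolution θ F₁ G₁ J x) (hy : IsImpulsiveSolution θ F₂ G₂ J y) :
    IsImpulsiveSolution θ (fun t _ => F₁ t (x t) - F₂ t (y t))
      (fun k _ => G₁ k (x (θ k)) - G₂ k (y (θ k))) J (fun t => x t - y t) := by
  refine ⟨fun t ht htr => (hx.1 t ht htr).sub (hy.1 t ht htr),
    fun k hk => (hx.2.1 k hk).sub (hy.2.1 k hk), fun k hk => ?_⟩
  have := (hx.2.2 k hk).sub (hy.2.2 k hk)
  rwa [add_sub_add_comm] at this

theorem IsImpulsiveSolution.mono {F : ℝ → E → E} {G : ℤ → E → E} {J J' : Set ℝ}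
    {x : ℝ → E} (hx : IsImpulsiveSolution θ F G J x) (h : J' ⊆ J) :
    IsImpulsiveSolution θ F G J' x :=
  ⟨fun t ht htr => (hx.1 t (h ht) htr).mono h,
    fun k hk => (hx.2.1 k (h hk)).mono_left (nhdsWithin_mono _ (inter_subset_inter_left _ h)),
    fun k hk => (hx.2.2 k (h hk)).mono_left (nhdsWithin_mono _ (inter_subset_inter_left _ h))⟩

theorem RegularMoments.add_natMul (hθ : θ ∈ RegularMoments p ω) (n : ℕ) (t : ℝ) :
    t + n * ω ∈ range θ ↔ t ∈ range θ := by
  constructor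
  · rintro ⟨k, hk⟩
    refine ⟨k - n * p, ?_⟩
    have := RegularMoments.shift hθ n (k - n * p)
    rw [sub_add_cancel] at this
    linarith
  · rintro ⟨k, rfl⟩
    exact ⟨k + n * p, RegularMoments.shift hθ n k⟩

/-- Translation of a solution on the line by a multiple of the period. -/
theorem IsImpulsiveSolution.shift (hθ : θ ∈ RegularMoments p ω) {F : ℝ → E → E} {G : ℤ → E → E}
    {x : ℝ → E} (hx : IsImpulsiveSolution θ F G univ x) (n : ℕ) :
    IsImpulsiveSolution θ (fun t => F (t + n * ω)) (fun k => G (k + n * p)) univ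
      (fun t => x (t + n * ω)) := by
  have hmap : ∀ (a : ℝ), Tendsto (fun t : ℝ => t + n * ω) (𝓝 a) (𝓝 (a + n * ω)) := fun a =>
    (continuous_add_const (n * ω)).tendsto a
  refine ⟨fun t _ htr => ?_, fun k _ => ?_, fun k _ => ?_⟩
  · have := hx.1 (t + n * ω) (mem_univ _) (mt (RegularMoments.add_natMul hθ n t).mp htr)
    rw [hasDerivWithinAt_univ] at this ⊢
    exact this.comp_add_const t (n * ω)
  · have h1 := hx.2.1 (k + n * p) (mem_univ _)
    rw [univ_inter, RegularMoments.shift hθ n k] at h1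
    rw [univ_inter]
    refine h1.comp (tendsto_nhdsWithin_iff.mpr ⟨(hmap _).mono_left nhdsWithin_le_nhds, ?_⟩)
    filter_upwards [self_mem_nhdsWithin] with t ht
    exact (add_lt_add_iff_right (n * ω)).mpr ht
  · have h1 := hx.2.2 (k + n * p) (mem_univ _)
    rw [univ_inter, RegularMoments.shift hθ n k] at h1
    rw [univ_inter]
    refine h1.comp (tendsto_nhdsWithin_iff.mpr ⟨(hmap _).mono_left nhdsWithin_le_nhds, ?_⟩)
    filter_upwards [self_mem_nhdsWithin] with t ht
    exact (add_lt_add_iff_right (n * ω)).mpr ht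

/-! ### Flows between moments and their concatenation. -/

theorem exp_mul_exp_neg {𝔸 : Type*} [NormedRing 𝔸] [NormedAlgebra ℝ 𝔸] [CompleteSpace 𝔸]
    (a : 𝔸) : NormedSpace.exp a * NormedSpace.exp (-a) = 1 := by
  let _ : NormedAlgebra ℚ 𝔸 := NormedAlgebra.restrictScalars ℚ ℝ _
  rw [← NormedSpace.exp_add_of_commute (Commute.refl a).neg_right, add_neg_cancel,
    NormedSpace.exp_zero]

/-- Global solvability of `x' = A x + r(t, x)` on a compact interval for a bounded Lipschitz
nonlinearity `r`. -/
theorem exists_hasDerivWithinAt_Icc {a b : ℝ} (hab : a ≤ b) (A : E →L[ℝ] E) {r : ℝ → E → E}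
    (hr : ContinuousOn (Function.uncurry r) (Icc a b ×ˢ univ)) {L M : ℝ} (hL : 0 ≤ L)
    (hrL : ∀ t ∈ Icc a b, ∀ x y, ‖r t x - r t y‖ ≤ L * ‖x - y‖)
    (hrM : ∀ t ∈ Icc a b, ∀ x, ‖r t x‖ ≤ M) (v : E) :
    ∃ x : ℝ → E, x a = v ∧
      ∀ t ∈ Icc a b, HasDerivWithinAt x (A (x t) + r t (x t)) (Icc a b) t := by
  let _ : NormedAlgebra ℚ (E →L[ℝ] E) := NormedAlgebra.restrictScalars ℚ ℝ _
  set e : ℝ → E →L[ℝ] E := fun t => NormedSpace.exp ((t - a) • A) with he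
  set e' : ℝ → E →L[ℝ] E := fun t => NormedSpace.exp (-((t - a) • A)) with he'
  have hec : Continuous e := NormedSpace.exp_continuous.comp
    ((continuous_id.sub continuous_const).smul continuous_const)
  have hec' : Continuous e' := NormedSpace.exp_continuous.comp
    ((continuous_id.sub continuous_const).smul continuous_const).neg
  have hee : ∀ t x, e t (e' t x) = x := by
    intro t x
    have h : e t * e' t = 1 := exp_mul_exp_neg _
    exact congrArg (fun T : E →L[ℝ] E => T x) h
  obtain ⟨K, hK⟩ := (isCompact_Icc (a := a) (b := b)).exists_bound_of_continuousOn
    hec.continuousOn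
  obtain ⟨K', hK'⟩ := (isCompact_Icc (a := a) (b := b)).exists_bound_of_continuousOn
    hec'.continuousOn
  have hK0 : 0 ≤ K := (norm_nonneg _).trans (hK a ⟨le_rfl, hab⟩)
  have hK0' : 0 ≤ K' := (norm_nonneg _).trans (hK' a ⟨le_rfl, hab⟩)
  have hM0 : 0 ≤ M := (norm_nonneg _).trans (hrM a ⟨le_rfl, hab⟩ 0)
  -- The substitution `x = e t (y t)` removes the unbounded linear term. The field for `y` is
  -- bounded by `K' * M`, so a ball of radius `K' * M * (b - a)` covers the whole interval at once.
  have hP : IsPicardLindelof (fun t y => e' t (r t (e t y))) (⟨a, le_rfl, hab⟩ : Icc a b) v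
      (Real.toNNReal (K' * M * (b - a))) 0 (Real.toNNReal (K' * M))
      (Real.toNNReal (K' * (L * K))) := by
    refine ⟨fun t ht => ?_, fun x _ => ?_, fun t ht x _ => ?_, ?_⟩
    · refine LipschitzOnWith.of_dist_le_mul fun x _ y _ => ?_
      rw [dist_eq_norm, dist_eq_norm, Real.coe_toNNReal _ (by positivity), ← map_sub]
      calc _ ≤ ‖e' t‖ * ‖r t (e t x) - r t (e t y)‖ := (e' t).le_opNorm _
        _ ≤ K' * (L * (K * ‖x - y‖)) := by
          refine mul_le_mul (hK' t ht) ((hrL t ht _ _).trans ?_) (norm_nonneg _) hK0'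
          refine mul_le_mul_of_nonneg_left ?_ hL
          rw [← map_sub]
          exact ((e t).le_opNorm _).trans (mul_le_mul_of_nonneg_right (hK t ht) (norm_nonneg _))
        _ = _ := by ring
    · refine ContinuousOn.clm_apply hec'.continuousOn ?_
      exact hr.comp (f := fun t => (t, e t x))
        (continuous_id.prodMk (hec.clm_apply continuous_const)).continuousOn
        fun t ht => ⟨ht, mem_univ _⟩
    · rw [Real.coe_toNNReal _ (by positivity)]
      exact ((e' t).le_opNorm _).trans (mul_le_mul (hK' t ht) (hrM t ht _) (norm_nonneg _) hK0')
    · have : 0 ≤ b - a := sub_nonneg.mpr hab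
      rw [Real.coe_toNNReal _ (by positivity), Real.coe_toNNReal _ (by positivity)]
      simp [this]
  obtain ⟨y, hy0, hy⟩ := hP.exists_eq_forall_mem_Icc_hasDerivWithinAt₀
  refine ⟨fun t => e t (y t), ?_, fun t ht => ?_⟩
  · change y a = v at hy0
    have h : e a = 1 := (congrArg NormedSpace.exp
      (show (a - a) • A = 0 by rw [sub_self]; exact zero_smul ℝ A)).trans NormedSpace.exp_zero
    change e a (y a) = v
    rw [h, hy0]
    rfl
  · have h1 : HasDerivAt e (A * e t) t := by
      have h2 : HasDerivAt (fun u : ℝ => NormedSpace.exp (u • A))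
        (A * NormedSpace.exp ((t - a) • A)) (t - a) := hasDerivAt_exp_smul_const' A (t - a)
      exact h2.comp_sub_const t a
    refine (h1.hasDerivWithinAt.clm_apply (hy t ht)).congr_deriv ?_
    rw [hee]
    rfl

theorem BPC.exists_continuousOn_Icc (hθ : θ ∈ RegularMoments p ω) {g : ℝ → E} (hg : g ∈ BPC θ)
    (k : ℤ) : ∃ g' : ℝ → E, ContinuousOn g' (Icc (θ k) (θ (k + 1))) ∧
      ∀ t ∈ Ioo (θ k) (θ (k + 1)), g' t = g t := by
  have hk : θ k < θ (k + 1) := hθ.2.2.1 (by omega)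
  obtain ⟨l, hl⟩ := hg.2.2.1 k
  have hc := hg.2.1 (k + 1)
  rw [add_sub_cancel_right] at hc
  refine ⟨extendFrom (Ioo (θ k) (θ (k + 1))) g,
    continuousOn_Icc_extendFrom_Ioo hc hl (hg.2.2.2 (k + 1)), fun t ht => ?_⟩
  exact extendFrom_extends hc t ht

/-- `S v` is the solution of `x' = F(t, x)` on `[θ k, θ (k + 1)]` with value `v` at the left end
point, and it depends continuously on `v`. -/
structure IsFlowBetweenMoments (θ : ℤ → ℝ) (F : ℝ → E → E) (k : ℤ) (S : E → ℝ → E) : Prop where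
  initial : ∀ v, S v (θ k) = v
  continuousOn : ∀ v, ContinuousOn (S v) (Icc (θ k) (θ (k + 1)))
  hasDerivAt : ∀ v, ∀ t ∈ Ioo (θ k) (θ (k + 1)), HasDerivAt (S v) (F t (S v t)) t
  continuous : ∀ t ∈ Icc (θ k) (θ (k + 1)), Continuous fun v => S v t

/-- The forcing is replaced by its continuous extension `g'` to the closed gap, and Grönwall gives
Lipschitz dependence on the initial value. -/
theorem exists_isFlowBetweenMoments (hθ : θ ∈ RegularMoments p ω) (A : E →L[ℝ] E)
    {f : ℝ → E → E} (hf : Continuous (Function.uncurry f)) {L M : ℝ} (hL : 0 ≤ L)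
    (hfL : ∀ t x y, ‖f t x - f t y‖ ≤ L * ‖x - y‖) (hfM : ∀ t x, ‖f t x‖ ≤ M)
    {g : ℝ → E} (hg : g ∈ BPC θ) (k : ℤ) :
    ∃ S, IsFlowBetweenMoments θ (fun t x => A x + f t x + g t) k S := by
  have hk : θ k < θ (k + 1) := hθ.2.2.1 (by omega)
  obtain ⟨g', hg'c, hg'⟩ := BPC.exists_continuousOn_Icc hθ hg k
  obtain ⟨M', hM'⟩ := isCompact_Icc.exists_bound_of_continuousOn hg'c
  have hex : ∀ v, ∃ x : ℝ → E, x (θ k) = v ∧ ∀ t ∈ Icc (θ k) (θ (k + 1)),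
      HasDerivWithinAt x (A (x t) + (f t (x t) + g' t)) (Icc (θ k) (θ (k + 1))) t := by
    intro v
    refine exists_hasDerivWithinAt_Icc hk.le A (r := fun t x => f t x + g' t) (M := M + M') ?_ hL
      (fun t _ x y => ?_) (fun t ht x => ?_) v
    · exact hf.continuousOn.add (hg'c.comp continuous_fst.continuousOn fun z hz => hz.1)
    · rw [add_sub_add_right_eq_sub]
      exact hfL t x y
    · exact (norm_add_le _ _).trans (add_le_add (hfM t x) (hM' t ht))
  choose S hS0 hS using hex
  have hSc : ∀ v, ContinuousOn (S v) (Icc (θ k) (θ (k + 1))) := fun v t ht =>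
    (hS v t ht).continuousWithinAt
  refine ⟨S, hS0, hSc, fun v t ht => ?_, fun t ht => ?_⟩
  · have h := (hS v t (Ioo_subset_Icc_self ht)).hasDerivAt (Icc_mem_nhds ht.1 ht.2)
    rwa [hg' t ht, ← add_assoc] at h
  · have hlip : ∀ u, LipschitzWith (Real.toNNReal (‖A‖ + L))
        (fun x => A x + (f u x + g' u)) := by
      intro u
      refine LipschitzWith.of_dist_le_mul fun x y => ?_
      rw [dist_eq_norm, dist_eq_norm, Real.coe_toNNReal _ (by positivity)]
      have e : A x + (f u x + g' u) - (A y + (f u y + g' u)) = A (x - y) + (f u x - f u y) := by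
        rw [map_sub]
        abel
      rw [e, add_mul]
      exact (norm_add_le _ _).trans (add_le_add (A.le_opNorm _) (hfL u x y))
    have hd : ∀ v, ∀ u ∈ Ico (θ k) (θ (k + 1)),
        HasDerivWithinAt (S v) (A (S v u) + (f u (S v u) + g' u)) (Ici u) u := fun v u hu =>
      (hS v u ⟨hu.1, hu.2.le⟩).mono_of_mem_nhdsWithin
        (mem_of_superset (Icc_mem_nhdsGE hu.2) (Icc_subset_Icc_left hu.1))
    refine LipschitzWith.continuous
      (K := Real.toNNReal (Real.exp (Real.toNNReal (‖A‖ + L) * (t - θ k)))) ?_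
    refine LipschitzWith.of_dist_le_mul fun v w => ?_
    rw [Real.coe_toNNReal _ (by positivity), mul_comm]
    exact dist_le_of_trajectories_ODE hlip (hSc v) (hd v) (hSc w) (hd w)
      (by rw [hS0, hS0]) t ht

theorem RegularMoments.index_unique (hθ : θ ∈ RegularMoments p ω) {j k : ℤ} {t : ℝ}
    (hj : t ∈ Ioc (θ j) (θ (j + 1))) (hk : t ∈ Ioc (θ k) (θ (k + 1))) : j = k := by
  have h1 := hθ.2.2.1.lt_iff_lt.mp (hj.1.trans_le hk.2)
  have h2 := hθ.2.2.1.lt_iff_lt.mp (hk.1.trans_le hj.2)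
  omega

/-- Concatenating the flows between the impulse moments yields a solution. -/
theorem isImpulsiveSolution_of_flow (hθ : θ ∈ RegularMoments p ω) {F : ℝ → E → E}
    {G : ℤ → E → E} {S : ℤ → E → ℝ → E} (hS : ∀ k, IsFlowBetweenMoments θ F k (S k))
    {J : Set ℝ} (hJ : ∀ t ∈ J, ∀ k, t ∈ Ioc (θ k) (θ (k + 1)) →
      θ k ∈ J ∨ t ∈ range θ ∧ J ∩ Iio t = ∅) {x : ℝ → E}
    (hx : ∀ k, θ k ∈ J → ∀ t ∈ Ioc (θ k) (θ (k + 1)), x t = S k (x (θ k) + G k (x (θ k))) t) :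
    IsImpulsiveSolution θ F G J x := by
  refine ⟨fun t ht htr => ?_, fun k hk => ?_, fun k hk => ?_⟩
  · obtain ⟨k, hk⟩ := RegularMoments.exists_mem_Ioc hθ t
    have hkJ : θ k ∈ J := (hJ t ht k hk).resolve_right fun h => htr h.1
    have hk' : t ∈ Ioo (θ k) (θ (k + 1)) :=
      ⟨hk.1, lt_of_le_of_ne hk.2 fun e => htr ⟨_, e.symm⟩⟩
    have he : x =ᶠ[𝓝 t] S k (x (θ k) + G k (x (θ k))) := by
      filter_upwards [isOpen_Ioo.mem_nhds hk'] with u hu using hx k hkJ u ⟨hu.1, hu.2.le⟩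
    have h1 := ((hS k).hasDerivAt _ t hk').congr_of_eventuallyEq he
    rw [← hx k hkJ t hk] at h1
    exact h1.hasDerivWithinAt
  · have hlt : θ (k - 1) < θ k := hθ.2.2.1 (by omega)
    have hk1 : k - 1 + 1 = k := by ring
    have hmem : θ k ∈ Ioc (θ (k - 1)) (θ (k - 1 + 1)) := by rw [hk1]; exact ⟨hlt, le_rfl⟩
    -- In the second case `θ k` is the initial moment of `J`, and the left-limit condition is
    -- vacuous.
    rcases hJ (θ k) hk (k - 1) hmem with hJk | ⟨_, hJk⟩
    · have h1 := ((hS (k - 1)).continuousOn (x (θ (k - 1)) + G (k - 1) (x (θ (k - 1))))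
        (θ k) ⟨hlt.le, hmem.2⟩)
      have h2 := h1.tendsto.mono_left (nhdsWithin_mono (θ k)
        (show Ioo (θ (k - 1)) (θ k) ⊆ _ from fun u hu => ⟨hu.1.le, hu.2.le.trans hmem.2⟩))
      rw [nhdsWithin_Ioo_eq_nhdsLT hlt, ← hx (k - 1) hJk (θ k) hmem] at h2
      refine (h2.congr' ?_).mono_left (nhdsWithin_mono _ inter_subset_right)
      filter_upwards [Ioo_mem_nhdsLT hlt] with u hu
      exact (hx (k - 1) hJk u ⟨hu.1, hu.2.le.trans hmem.2⟩).symm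
    · rw [hJk, nhdsWithin_empty]
      exact tendsto_bot
  · have hlt : θ k < θ (k + 1) := hθ.2.2.1 (by omega)
    have h1 := ((hS k).continuousOn (x (θ k) + G k (x (θ k))) (θ k) ⟨le_rfl, hlt.le⟩)
    have h2 := h1.tendsto.mono_left (nhdsWithin_mono (θ k) Ioo_subset_Icc_self)
    rw [nhdsWithin_Ioo_eq_nhdsGT hlt, (hS k).initial] at h2
    refine (h2.congr' ?_).mono_left (nhdsWithin_mono _ inter_subset_right)
    filter_upwards [Ioo_mem_nhdsGT hlt] with u hu
    exact (hx k hk u ⟨hu.1, hu.2.le⟩).symm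

theorem exists_concatenated_flow (hθ : θ ∈ RegularMoments p ω) (G : ℤ → E → E)
    (S : ℤ → E → ℝ → E) (K : ℤ) :
    ∃ x : ℝ → E, (∀ t ≤ θ K, x t = 0) ∧
      ∀ k, K ≤ k → ∀ t ∈ Ioc (θ k) (θ (k + 1)), x t = S k (x (θ k) + G k (x (θ k))) t := by
  have hm := hθ.2.2.1
  choose idx hidx using RegularMoments.exists_mem_Ioc hθ
  -- `a n` is the value at `θ (K + n)` before the jump, computed recursively from zero.
  set a : ℕ → E := fun n => Nat.rec 0
    (fun n y => S (K + n) (y + G (K + n) y) (θ (K + n + 1))) n with ha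
  set x : ℝ → E := fun t => if t ≤ θ K then 0 else
    S (idx t) (a (idx t - K).toNat + G (idx t) (a (idx t - K).toNat)) t with hx
  have hxt : ∀ (n : ℕ), ∀ t ∈ Ioc (θ (K + n)) (θ (K + n + 1)),
      x t = S (K + n) (a n + G (K + n) (a n)) t := by
    intro n t ht
    have h1 : ¬ t ≤ θ K := not_le.mpr ((hm.monotone (by omega)).trans_lt ht.1)
    have h2 : idx t = K + n := RegularMoments.index_unique hθ (hidx t) ht
    have h3 : (K + n - K).toNat = n := by omega
    simp only [hx, if_neg h1, h2, h3]
  have hxa : ∀ n : ℕ, x (θ (K + n)) = a n := by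
    intro n
    cases n with
    | zero => simp [hx, ha]
    | succ n =>
      have h : K + ((n + 1 : ℕ) : ℤ) = K + n + 1 := by push_cast; ring
      rw [h, hxt n _ ⟨hm (by omega), le_rfl⟩]
  refine ⟨x, fun t ht => by simp [hx, ht], fun k hk t ht => ?_⟩
  obtain ⟨n, rfl⟩ := Int.le.dest hk
  rw [hxt n t ht, hxa]

/-! ### Comparison of solutions and the bounded solution on the line. -/

/-- The field `A x + f(t, x) + g(t)`. -/
def semilinearField (A : E →L[ℝ] E) (f : ℝ → E → E) (g : ℝ → E) (t : ℝ) (x : E) : E :=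
  A x + f t x + g t

/-- The impulse action `B x + h(x) + γ k`. -/
def semilinearJump (B : E →L[ℝ] E) (h : E → E) (γ : ℤ → E) (k : ℤ) (x : E) : E :=
  B x + h x + γ k

/-- The difference satisfies the linear system up to Lipschitz terms and the difference of the
forcings. Two fields `f₁`, `f₂` are allowed so that a time translate of `f` fits. -/
theorem PerturbationBound.norm_solution_sub_le {A B : E →L[ℝ] E} {Lf Lh C κ : ℝ}
    (hP : PerturbationBound θ A B Lf Lh C κ) {f₁ f₂ : ℝ → E → E} {h : E → E}
    (hf : ∀ t x y, ‖f₁ t x - f₂ t y‖ ≤ Lf * ‖x - y‖) (hh : ∀ x y, ‖h x - h y‖ ≤ Lh * ‖x - y‖)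
    {g₁ g₂ : ℝ → E} {γ₁ γ₂ : ℤ → E} {s T : ℝ} {x y : ℝ → E}
    (hx : IsImpulsiveSolution θ (semilinearField A f₁ g₁) (semilinearJump B h γ₁) (Ici s) x)
    (hy : IsImpulsiveSolution θ (semilinearField A f₂ g₂) (semilinearJump B h γ₂) (Ici s) y)
    {ε δ : ℝ} (hε : 0 ≤ ε) (hδ : 0 < δ) (hxy : ‖x s - y s‖ ≤ δ)
    (hg : ∀ u ∈ Ico s T, ‖g₁ u - g₂ u‖ ≤ ε) (hγ : ∀ k, θ k ∈ Ico s T → ‖γ₁ k - γ₂ k‖ ≤ ε)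
    {t : ℝ} (ht : t ∈ Icc s T) :
    ‖x t - y t‖ ≤ C * (δ * Real.exp (-κ * (t - s)) + ε) := by
  refine hP s T (fun t => x t - y t) _ _ ε δ (hx.sub hy) hε hδ hxy
    (fun u hu _ => ?_) (fun k hk => ?_) t ht
  · have e : semilinearField A f₁ g₁ u (x u) - semilinearField A f₂ g₂ u (y u) -
        A (x u - y u) = (f₁ u (x u) - f₂ u (y u)) + (g₁ u - g₂ u) := by
      simp only [semilinearField, map_sub]
      abel
    rw [e]
    exact (norm_add_le _ _).trans (add_le_add (hf _ _ _) (hg u hu))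
  · have e : semilinearJump B h γ₁ k (x (θ k)) - semilinearJump B h γ₂ k (y (θ k)) -
        B (x (θ k) - y (θ k)) = (h (x (θ k)) - h (y (θ k))) + (γ₁ k - γ₂ k) := by
      simp only [semilinearJump, map_sub]
      abel
    rw [e]
    exact (norm_add_le _ _).trans (add_le_add (hh _ _) (hγ k hk))

theorem IsImpulsiveSolution.mem_BPC (hθ : θ ∈ RegularMoments p ω) {F : ℝ → E → E}
    {G : ℤ → E → E} {x : ℝ → E} (hx : IsImpulsiveSolution θ F G univ x) {R : ℝ}
    (hR : ∀ t, ‖x t‖ ≤ R) : x ∈ BPC θ := by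
  refine ⟨⟨R, hR⟩, fun k t ht => ?_, fun k => ⟨_, by simpa using hx.2.2 k (mem_univ _)⟩,
    fun k => by simpa using hx.2.1 k (mem_univ _)⟩
  have h : t ∉ range θ := RegularMoments.notMem_range hθ (k := k - 1) (by simpa using ht)
  exact (hx.1 t (mem_univ _) h).continuousWithinAt.mono (subset_univ _)

/-- The quasilinear system has a bounded solution on the line. -/
theorem PerturbationBound.exists_solution (hθ : θ ∈ RegularMoments p ω) {A B : E →L[ℝ] E}
    {Lf Lh C κ : ℝ} (hP : PerturbationBound θ A B Lf Lh C κ) (hC : 0 < C) (hκ : 0 < κ)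
    (hLf : 0 ≤ Lf) (hLh : 0 ≤ Lh) {f : ℝ → E → E} {h : E → E}
    (hfc : Continuous (Function.uncurry f)) (hhc : Continuous h)
    (hf : ∀ t x y, ‖f t x - f t y‖ ≤ Lf * ‖x - y‖) (hh : ∀ x y, ‖h x - h y‖ ≤ Lh * ‖x - y‖)
    {Mf Mh : ℝ} (hfM : ∀ t x, ‖f t x‖ ≤ Mf) (hhM : ∀ x, ‖h x‖ ≤ Mh)
    {g : ℝ → E} (hg : g ∈ BPC θ) {γ : ℤ → E} {Mγ : ℝ} (hγ : ∀ k, ‖γ k‖ ≤ Mγ) :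
    ∃ φ ∈ BPC θ, IsImpulsiveSolution θ (semilinearField A f g) (semilinearJump B h γ) univ φ := by
  have hm := hθ.2.2.1
  obtain ⟨Mg, hgM⟩ := hg.1
  choose S hS using fun k => exists_isFlowBetweenMoments hθ A hfc hLf hf hfM hg k
  choose x hx0 hx using fun n : ℕ =>
    exists_concatenated_flow hθ (semilinearJump B h γ) S (-(n : ℤ))
  have hsol : ∀ n : ℕ, IsImpulsiveSolution θ (semilinearField A f g) (semilinearJump B h γ)
      (Ici (θ (-(n : ℤ)))) (x n) := by
    intro n
    refine isImpulsiveSolution_of_flow hθ hS (fun t ht k hk => ?_) fun k hk t ht =>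
      hx n k (hm.le_iff_le.mp hk) t ht
    rcases eq_or_lt_of_le (show θ (-(n : ℤ)) ≤ t from ht) with h1 | h1
    · refine Or.inr ⟨⟨_, h1⟩, ?_⟩
      rw [h1]
      exact Ici_inter_Iio.trans (Ico_self _)
    · have := hm.lt_iff_lt.mp (h1.trans_le hk.2)
      exact Or.inl (hm.monotone (by omega))
  have hM : 0 ≤ Mf ∧ 0 ≤ Mh ∧ 0 ≤ Mg ∧ 0 ≤ Mγ :=
    ⟨(norm_nonneg _).trans (hfM 0 0), (norm_nonneg _).trans (hhM 0),
      (norm_nonneg _).trans (hgM 0), (norm_nonneg _).trans (hγ 0)⟩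
  obtain ⟨hMf, hMh, hMg, hMγ⟩ := hM
  set ε := Mf + Mg + Mh + Mγ with hε
  have hε0 : 0 ≤ ε := by positivity
  set R := C * (1 + ε) with hR
  have hR0 : 0 < R := by positivity
  have hbdd : ∀ n t, ‖x n t‖ ≤ R := by
    intro n t
    rcases le_total t (θ (-(n : ℤ))) with h1 | h1
    · rw [hx0 n t h1, norm_zero]
      exact hR0.le
    -- `f` and `h` are bounded, so they are counted in `ε` along with the forcings, and the
    -- Lipschitz terms are mere slack.
    · refine (hP (θ (-(n : ℤ))) t (x n) (fun t => semilinearField A f g t (x n t))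
        (fun k => semilinearJump B h γ k (x n (θ k))) ε 1 (hsol n) hε0 one_pos
        (by rw [hx0 n _ le_rfl, norm_zero]; exact zero_le_one)
        (fun u _ _ => ?_) (fun k _ => ?_) t ⟨h1, le_rfl⟩).trans ?_
      · have e : semilinearField A f g u (x n u) - A (x n u) = f u (x n u) + g u := by
          simp only [semilinearField]
          abel
        rw [e]
        have := norm_add_le (f u (x n u)) (g u)
        have := hfM u (x n u)
        have := hgM u
        have := mul_nonneg hLf (norm_nonneg (x n u))
        linarith
      · have e : semilinearJump B h γ k (x n (θ k)) - B (x n (θ k)) = h (x n (θ k)) + γ k := by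
          simp only [semilinearJump]
          abel
        rw [e]
        have := norm_add_le (h (x n (θ k))) (γ k)
        have := hhM (x n (θ k))
        have := hγ k
        have := mul_nonneg hLh (norm_nonneg (x n (θ k)))
        linarith
      · refine mul_le_mul_of_nonneg_left ?_ hC.le
        rw [one_mul]
        refine add_le_add_left (Real.exp_le_one_iff.mpr ?_) _
        nlinarith
  -- Before `θ (-n)` the exponential is at least `1` and `x n` vanishes, so the same bound holds
  -- there; this gives a Cauchy estimate at every `t`.
  have hdiff : ∀ t, ∀ n k : ℕ, n ≤ k → dist (x n t) (x k t) ≤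
      (C * R + R) * Real.exp (-κ * (t - θ (-(n : ℤ)))) := by
    intro t n k hnk
    rw [dist_eq_norm, add_mul]
    rcases le_total t (θ (-(n : ℤ))) with h1 | h1
    · rw [hx0 n t h1, zero_sub, norm_neg]
      have h2 : 1 ≤ Real.exp (-κ * (t - θ (-(n : ℤ)))) := by
        rw [Real.one_le_exp_iff]
        nlinarith
      have h3 := hbdd k t
      have h4 : 0 ≤ C * R * Real.exp (-κ * (t - θ (-(n : ℤ)))) := by positivity
      nlinarith
    · have h2 := hP.norm_solution_sub_le hf hh (hsol n) ((hsol k).mono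
        (Ici_subset_Ici.mpr (hm.monotone (by omega)))) (T := t) le_rfl hR0
        (by rw [hx0 n _ le_rfl, zero_sub, norm_neg]; exact hbdd k _)
        (fun u _ => by simp) (fun k _ => by simp) ⟨h1, le_rfl⟩
      have h4 : 0 ≤ R * Real.exp (-κ * (t - θ (-(n : ℤ)))) := by positivity
      linarith
  have hθbot : Tendsto (fun n : ℕ => θ (-(n : ℤ))) atTop atBot := by
    rw [tendsto_atBot]
    intro b
    obtain ⟨k, hk⟩ := RegularMoments.exists_mem_Ioc hθ b
    filter_upwards [eventually_ge_atTop k.natAbs] with n hn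
    exact (hm.monotone (by omega)).trans hk.1.le
  have hconv : ∀ t, ∃ l, Tendsto (fun n => x n t) atTop (𝓝 l) := by
    intro t
    refine cauchySeq_tendsto_of_complete (cauchySeq_of_le_tendsto_0' _ (hdiff t) ?_)
    rw [← mul_zero (C * R + R)]
    refine Tendsto.const_mul _ (Real.tendsto_exp_atBot.comp ?_)
    exact (tendsto_atTop_add_const_left _ t (tendsto_neg_atBot_atTop.comp hθbot)
      ).const_mul_atTop_of_neg (neg_lt_zero.mpr hκ) |>.congr fun n => by simp [sub_eq_add_neg]
  choose φ hφ using hconv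
  have hφR : ∀ t, ‖φ t‖ ≤ R := fun t => le_of_tendsto' (hφ t).norm fun n => hbdd n t
  have hjump : ∀ k, Continuous (semilinearJump B h γ k) := fun k =>
    (B.continuous.add hhc).add continuous_const
  -- The pointwise limit inherits the flow relation on each gap by continuity of the flow in its
  -- initial value; no convergence of derivatives is needed.
  have hφsol : IsImpulsiveSolution θ (semilinearField A f g) (semilinearJump B h γ) univ φ := by
    refine isImpulsiveSolution_of_flow hθ hS (fun t _ k _ => Or.inl (mem_univ _))
      fun k _ t ht => ?_
    have h1 := (((hS k).continuous t ⟨ht.1.le, ht.2⟩).tendsto _).comp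
      ((hφ (θ k)).add (((hjump k).tendsto _).comp (hφ (θ k))))
    refine tendsto_nhds_unique (hφ t) (h1.congr' ?_)
    filter_upwards [eventually_ge_atTop k.natAbs] with n hn
    exact (hx n k (by omega) t ht).symm
  exact ⟨φ, hφsol.mem_BPC hθ hφR, hφsol⟩

/-! ### Step forcings and closure properties of `BPC`. -/

/-- Taking every `p`-th moment leaves one per period, so the lookup lemmas for gaps also locate the
steps of a forcing constant on `p` consecutive gaps. -/
theorem RegularMoments.comp_mul (hθ : θ ∈ RegularMoments p ω) :
    (fun k : ℤ => θ (k * p)) ∈ RegularMoments 1 ω := by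
  refine ⟨one_pos, hθ.2.1, fun j k hjk => hθ.2.2.1 ?_, fun k => ?_⟩
  · exact mul_lt_mul_of_pos_right hjk (by exact_mod_cast hθ.1)
  · have := hθ.2.2.2 (k * p)
    simp only [Nat.cast_one, add_mul, one_mul]
    exact this

theorem exists_step (hθ : θ ∈ RegularMoments p ω) (α : ℤ → E) :
    ∃ g : ℝ → E, ∀ k : ℤ, ∀ t ∈ Ioc (θ (k * p)) (θ ((k + 1) * p)), g t = α k := by
  choose idx hidx using RegularMoments.exists_mem_Ioc (RegularMoments.comp_mul hθ)
  refine ⟨fun t => α (idx t), fun k t ht => ?_⟩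
  have : idx t = k := RegularMoments.index_unique (RegularMoments.comp_mul hθ) (hidx t) ht
  simp only [this]

theorem step_mem_BPC (hθ : θ ∈ RegularMoments p ω) {α : ℤ → E} {M : ℝ} (hα : ∀ k, ‖α k‖ ≤ M)
    {g : ℝ → E} (hg : ∀ k : ℤ, ∀ t ∈ Ioc (θ (k * p)) (θ ((k + 1) * p)), g t = α k) :
    g ∈ BPC θ := by
  have hp : (0 : ℤ) < p := by exact_mod_cast hθ.1
  have hm := hθ.2.2.1
  have hgj : ∀ j : ℤ, ∀ t ∈ Ioc (θ j) (θ (j + 1)), g t = α (j / p) := by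
    intro j t ht
    refine hg _ t ⟨(hm.monotone ?_).trans_lt ht.1, ht.2.trans (hm.monotone ?_)⟩
    · exact Int.ediv_mul_le j hp.ne'
    · exact Int.lt_ediv_add_one_mul_self j hp
  have hgj' : ∀ k : ℤ, ∀ t ∈ Ioc (θ (k - 1)) (θ k), g t = α ((k - 1) / p) := fun k t ht =>
    hgj (k - 1) t (by simpa using ht)
  refine ⟨⟨M, fun t => ?_⟩, fun k => ?_, fun k => ⟨α (k / p), ?_⟩, fun k => ?_⟩
  · obtain ⟨k, hk⟩ := RegularMoments.exists_mem_Ioc hθ t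
    rw [hgj k t hk]
    exact hα _
  · exact continuousOn_const.congr fun t ht => hgj' k t ⟨ht.1, ht.2.le⟩
  · refine tendsto_const_nhds.congr' ?_
    filter_upwards [Ioo_mem_nhdsGT (hm (lt_add_one k))] with t ht
    exact (hgj k t ⟨ht.1, ht.2.le⟩).symm
  · have hk : θ (k - 1) < θ k := hm (by omega)
    rw [hgj' k (θ k) ⟨hk, le_rfl⟩]
    refine tendsto_const_nhds.congr' ?_
    filter_upwards [Ioo_mem_nhdsLT hk] with t ht
    exact (hgj' k t ⟨ht.1, ht.2.le⟩).symm

theorem BPC.add {φ ψ : ℝ → E} (hφ : φ ∈ BPC θ) (hψ : ψ ∈ BPC θ) :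
    (fun t => φ t + ψ t) ∈ BPC θ := by
  obtain ⟨⟨C, hC⟩, h1, h2, h3⟩ := hφ
  obtain ⟨⟨D, hD⟩, h1', h2', h3'⟩ := hψ
  refine ⟨⟨C + D, fun t => (norm_add_le _ _).trans (add_le_add (hC t) (hD t))⟩,
    fun k => (h1 k).add (h1' k), fun k => ?_, fun k => (h3 k).add (h3' k)⟩
  obtain ⟨l, hl⟩ := h2 k
  obtain ⟨l', hl'⟩ := h2' k
  exact ⟨l + l', hl.add hl'⟩

theorem BPC.neg {φ : ℝ → E} (hφ : φ ∈ BPC θ) : (fun t => -φ t) ∈ BPC θ := by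
  obtain ⟨⟨C, hC⟩, h1, h2, h3⟩ := hφ
  refine ⟨⟨C, fun t => by rw [norm_neg]; exact hC t⟩, fun k => (h1 k).neg, fun k => ?_,
    fun k => (h3 k).neg⟩
  obtain ⟨l, hl⟩ := h2 k
  exact ⟨-l, hl.neg⟩

/-! ### Unpredictability of the bounded solution. -/

theorem IsImpulsiveSolution.hasDerivAt {F : ℝ → E → E} {G : ℤ → E → E} {x : ℝ → E}
    (hx : IsImpulsiveSolution θ F G univ x) {t : ℝ} (ht : t ∉ range θ) :
    HasDerivAt x (F t (x t)) t :=
  hasDerivWithinAt_univ.mp (hx.1 t (mem_univ _) ht)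

/-- Bounded derivatives make a solution Lipschitz between consecutive impulse moments. -/
theorem IsImpulsiveSolution.norm_sub_le_of_mem_Ioo (hθ : θ ∈ RegularMoments p ω)
    {F : ℝ → E → E} {G : ℤ → E → E} {x : ℝ → E} (hx : IsImpulsiveSolution θ F G univ x) {D : ℝ}
    (hD : ∀ t, ‖F t (x t)‖ ≤ D) {k : ℤ} {a b : ℝ} (ha : a ∈ Ioo (θ k) (θ (k + 1)))
    (hb : b ∈ Ioo (θ k) (θ (k + 1))) : ‖x b - x a‖ ≤ D * |b - a| :=
  (convex_Ioo _ _).norm_image_sub_le_of_norm_hasDerivWithin_le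
    (fun _ ht => (hx.hasDerivAt (RegularMoments.notMem_range hθ ht)).hasDerivWithinAt)
    (fun t _ => hD t) ha hb

/-- A function with `‖w' - c‖ ≤ K ‖w‖` cannot remain small on an interval if `c` is not small. -/
theorem exists_norm_ge_of_hasDerivAt {w w' : ℝ → E} {a b K υ : ℝ} {c : E} (hab : a < b)
    (hK : 0 ≤ K) (hc : υ ≤ ‖c‖) (hw : ∀ t ∈ Icc a b, HasDerivAt w (w' t) t)
    (hw' : ∀ t ∈ Icc a b, ‖w' t - c‖ ≤ K * ‖w t‖) :
    ∃ t ∈ Icc a b, (b - a) * υ / (2 + K * (b - a)) ≤ ‖w t‖ := by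
  have hl : 0 < b - a := sub_pos.mpr hab
  by_contra! hcon
  set η := (b - a) * υ / (2 + K * (b - a)) with hη
  have hη' : η * (2 + K * (b - a)) = (b - a) * υ := div_mul_cancel₀ _ (by positivity)
  -- If `‖w‖ < η` throughout, then `w t - t • c` varies by at most `K * η * (b - a)`, which forces
  -- `(b - a) * ‖c‖ < η * (2 + K * (b - a))`.
  have h1 := (convex_Icc a b).norm_image_sub_le_of_norm_hasDerivWithin_le (C := K * η)
    (f := fun t => w t - t • c) (f' := fun t => w' t - c)
    (fun t ht => ((hw t ht).sub (by simpa using (hasDerivAt_id t).smul_const c)).hasDerivWithinAt)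
    (fun t ht => (hw' t ht).trans (mul_le_mul_of_nonneg_left (hcon t ht).le hK))
    (left_mem_Icc.mpr hab.le) (right_mem_Icc.mpr hab.le)
  have h2 : (b - a) • c = w b - w a - (w b - b • c - (w a - a • c)) := by
    rw [sub_smul]
    abel
  have h3 := congrArg norm h2
  rw [norm_smul, Real.norm_of_nonneg hl.le] at h3
  have h4 := norm_sub_le (w b - w a) (w b - b • c - (w a - a • c))
  have h5 := norm_sub_le (w b) (w a)
  have h6 := hcon a (left_mem_Icc.mpr hab.le)
  have h7 := hcon b (right_mem_Icc.mpr hab.le)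
  rw [Real.norm_of_nonneg hl.le] at h1
  have h8 := mul_le_mul_of_nonneg_left hc hl.le
  linarith

theorem periodic_add_natMul {f : ℝ → E → E} (hf : ∀ t x, f (t + ω) x = f t x) (n : ℕ) (t : ℝ)
    (x : E) : f (t + n * ω) x = f t x :=
  (show Function.Periodic (fun t => f t x) ω from fun t => hf t x).nat_mul n t

theorem norm_semilinearField_le {A : E →L[ℝ] E} {f : ℝ → E → E} {g : ℝ → E} {Mf Mg R : ℝ}
    (hfM : ∀ t x, ‖f t x‖ ≤ Mf) (hgM : ∀ t, ‖g t‖ ≤ Mg) {t : ℝ} {x : E} (hx : ‖x‖ ≤ R) :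
    ‖semilinearField A f g t x‖ ≤ ‖A‖ * R + Mf + Mg :=
  (norm_add₃_le ..).trans (add_le_add (add_le_add
    ((A.le_opNorm x).trans (mul_le_mul_of_nonneg_left hx (norm_nonneg _))) (hfM t x)) (hgM t))

theorem step_add_natMul (hθ : θ ∈ RegularMoments p ω) {α : ℤ → E} {g : ℝ → E}
    (hg : ∀ k : ℤ, ∀ t ∈ Ioc (θ (k * p)) (θ ((k + 1) * p)), g t = α k) (n : ℕ) {k : ℤ} {t : ℝ}
    (ht : t ∈ Ioc (θ (k * p)) (θ ((k + 1) * p))) : g (t + n * ω) = α (k + n) := by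
  have h1 := RegularMoments.shift hθ n (k * p)
  have h2 := RegularMoments.shift hθ n ((k + 1) * p)
  refine hg _ _ ⟨?_, ?_⟩
  · rw [add_mul, h1]
    linarith [ht.1]
  · rw [add_right_comm, add_mul, h2]
    linarith [ht.2]

/-- The translate solves the same system with `α` shifted: `f` and the moments are periodic, and the
impulses carry no `γ`. Starting far to the left of `K` makes the transient small; only finitely many
steps of the forcing then matter. -/
theorem PerturbationBound.tendsto_shift (hθ : θ ∈ RegularMoments p ω) {A B : E →L[ℝ] E}
    {Lf Lh C κ : ℝ} (hP : PerturbationBound θ A B Lf Lh C κ) (hC : 0 < C) (hκ : 0 < κ)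
    {f : ℝ → E → E} {h : E → E} (hfp : ∀ t x, f (t + ω) x = f t x)
    (hf : ∀ t x y, ‖f t x - f t y‖ ≤ Lf * ‖x - y‖) (hh : ∀ x y, ‖h x - h y‖ ≤ Lh * ‖x - y‖)
    {α : ℤ → E} {q : ℕ → ℕ} (hq : ∀ k : ℤ, Tendsto (fun n => ‖α (k + q n) - α k‖) atTop (𝓝 0))
    {g : ℝ → E} (hg : ∀ k : ℤ, ∀ t ∈ Ioc (θ (k * p)) (θ ((k + 1) * p)), g t = α k)
    {ψ : ℝ → E} {R : ℝ} (hR : ∀ t, ‖ψ t‖ ≤ R)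
    (hψ : IsImpulsiveSolution θ (semilinearField A f g) (semilinearJump B h 0) univ ψ)
    {K : Set ℝ} (hK : IsCompact K) :
    TendstoUniformlyOn (fun (n : ℕ) (t : ℝ) => ‖ψ (t + q n * ω) - ψ t‖) (fun _ => 0) atTop K := by
  obtain ⟨a, ha⟩ := hK.bddBelow
  obtain ⟨b, hb⟩ := hK.bddAbove
  rw [Metric.tendstoUniformlyOn_iff]
  intro ε hε
  have hR0 : 0 ≤ R := (norm_nonneg _).trans (hR 0)
  have hθ' := RegularMoments.comp_mul hθ
  have hlim : Tendsto (fun s => C * ((2 * R + 1) * Real.exp (-κ * (a - s)))) atBot (𝓝 0) := by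
    rw [← mul_zero C, ← mul_zero (2 * R + 1)]
    refine Tendsto.const_mul _ (Tendsto.const_mul _ (Real.tendsto_exp_atBot.comp ?_))
    exact ((tendsto_atTop_add_const_left _ a tendsto_neg_atBot_atTop).const_mul_atTop_of_neg
      (neg_lt_zero.mpr hκ)).congr fun s => by simp [sub_eq_add_neg]
  obtain ⟨s, hs, hsa⟩ := ((hlim.eventually_lt_const (half_pos hε)).and
    (eventually_le_atBot a)).exists
  set ε' := ε / 2 / C with hε'
  have hε'0 : 0 < ε' := by positivity
  obtain ⟨i, hi⟩ := RegularMoments.exists_mem_Ioc hθ' s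
  obtain ⟨j, hj⟩ := RegularMoments.exists_mem_Ioc hθ' b
  have hev : ∀ᶠ n in atTop, ∀ k ∈ Icc i j, ‖α (k + q n) - α k‖ ≤ ε' :=
    (eventually_all_finite (finite_Icc i j)).mpr fun k _ => (hq k).eventually_le_const hε'0
  filter_upwards [hev] with n hn t ht
  rw [dist_zero_left, norm_norm]
  have hsol := hψ.shift hθ (q n)
  have hgs : ∀ u ∈ Ico s b, ‖g (u + q n * ω) - g u‖ ≤ ε' := by
    intro u hu
    obtain ⟨k, hk⟩ := RegularMoments.exists_mem_Ioc hθ' u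
    rw [step_add_natMul hθ hg (q n) hk, hg k u hk]
    have h1 := hθ'.2.2.1.lt_iff_lt.mp (hi.1.trans_le (hu.1.trans hk.2))
    have h2 := hθ'.2.2.1.lt_iff_lt.mp (hk.1.trans_le (hu.2.le.trans hj.2))
    exact hn k ⟨by omega, by omega⟩
  have hx : IsImpulsiveSolution θ (semilinearField A (fun t => f (t + q n * ω))
      (fun t => g (t + q n * ω))) (semilinearJump B h 0) (Ici s) (fun t => ψ (t + q n * ω)) :=
    hsol.mono (subset_univ _)
  have key := hP.norm_solution_sub_le (T := b) (δ := 2 * R + 1) (ε := ε') (t := t)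
    (fun t x y => by rw [periodic_add_natMul hfp]; exact hf t x y) hh hx
    (hψ.mono (subset_univ _)) hε'0.le (by positivity)
    (by linarith [norm_sub_le (ψ (s + q n * ω)) (ψ s), hR (s + q n * ω), hR s]) hgs
    (fun k _ => by simpa using hε'0.le) ⟨hsa.trans (ha ht), hb ht⟩
  have h3 : Real.exp (-κ * (t - s)) ≤ Real.exp (-κ * (a - s)) := by
    rw [Real.exp_le_exp]
    nlinarith [ha ht]
  have h4 : C * ((2 * R + 1) * Real.exp (-κ * (t - s))) ≤
      C * ((2 * R + 1) * Real.exp (-κ * (a - s))) := by gcongr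
  have h5 : C * ε' = ε / 2 := by rw [hε']; field_simp
  rw [mul_add] at key
  linarith

/-- The bounded solution of the quasilinear system driven by an unpredictable sequence is
unpredictable. -/
theorem PerturbationBound.isUnpredictable (hθ : θ ∈ RegularMoments p ω) {A B : E →L[ℝ] E}
    {Lf Lh C κ : ℝ} (hP : PerturbationBound θ A B Lf Lh C κ) (hC : 0 < C) (hκ : 0 < κ)
    (hLf : 0 ≤ Lf) {f : ℝ → E → E} {h : E → E} (hfp : ∀ t x, f (t + ω) x = f t x)
    (hf : ∀ t x y, ‖f t x - f t y‖ ≤ Lf * ‖x - y‖) (hh : ∀ x y, ‖h x - h y‖ ≤ Lh * ‖x - y‖)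
    {Mf : ℝ} (hfM : ∀ t x, ‖f t x‖ ≤ Mf)
    {α : ℤ → E} (hα : IsUnpredictableSeq α)
    {g : ℝ → E} (hg : ∀ k : ℤ, ∀ t ∈ Ioc (θ (k * p)) (θ ((k + 1) * p)), g t = α k)
    {ψ : ℝ → E} (hψB : ψ ∈ BPC θ)
    (hψ : IsImpulsiveSolution θ (semilinearField A f g) (semilinearJump B h 0) univ ψ) :
    IsUnpredictable θ ψ := by
  obtain ⟨⟨Mα, hMα⟩, υ, q, r, hυ, -, -, hq, hr, hconv, hsep⟩ := hα
  obtain ⟨R, hR⟩ := hψB.1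
  obtain ⟨Mg, hgM⟩ := (step_mem_BPC hθ hMα hg).1
  have hω := hθ.2.1
  have hm := hθ.2.2.1
  set D := ‖A‖ * R + Mf + Mg with hD
  have hFD : ∀ t, ‖semilinearField A f g t (ψ t)‖ ≤ D := fun t =>
    norm_semilinearField_le hfM hgM (hR t)
  have hD0 : 0 ≤ D := (norm_nonneg _).trans (hFD 0)
  set ℓ := θ 1 - θ 0 with hℓ
  have hℓ0 : 0 < ℓ := sub_pos.mpr (hm one_pos)
  set K := ‖A‖ + Lf with hK
  have hK0 : 0 ≤ K := by positivity
  -- This is the bound of `exists_norm_ge_of_hasDerivAt` on the middle half of a gap, of length `ℓ /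
  -- 2`.
  set η := ℓ / 2 * υ / (2 + K * (ℓ / 2)) with hη
  have hη0 : 0 < η := by positivity
  -- With `ν ≤ ℓ / 8` the window around `τ n` stays inside the gap; the other bound lets the
  -- difference, which is `2 * D`-Lipschitz there, lose at most `η / 2`.
  set ν := min (ℓ / 8) (η / (4 * (D + 1))) with hν
  have hν0 : 0 < ν := by positivity
  have hmom : ∀ n : ℕ, θ (0 + n * p) = θ 0 + n * ω ∧ θ (0 + n * p + 1) = θ 0 + n * ω + ℓ := by
    intro n
    refine ⟨RegularMoments.shift hθ n 0, ?_⟩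
    rw [zero_add, add_comm, RegularMoments.shift hθ n 1]
    ring
  have hIoo : ∀ n : ℕ, ∀ t, θ 0 + n * ω < t → t < θ 0 + n * ω + ℓ →
      t ∈ Ioo (θ (0 + n * p)) (θ (0 + n * p + 1)) := fun n t h1 h2 =>
    ⟨(hmom n).1.trans_lt h1, h2.trans_eq (hmom n).2.symm⟩
  have hstep : ∀ n : ℕ, ∀ t, θ 0 + n * ω < t → t < θ 0 + n * ω + ℓ →
      t ∈ Ioc (θ ((n : ℤ) * p)) (θ (((n : ℤ) + 1) * p)) := by
    intro n t h1 h2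
    have h3 := hIoo n t h1 h2
    rw [zero_add] at h3
    refine ⟨h3.1, h3.2.le.trans (hm.monotone ?_)⟩
    rw [add_mul, one_mul]
    have : (1 : ℤ) ≤ p := by exact_mod_cast hθ.1
    omega
  have hw : ∀ n, ∀ t, θ 0 + r n * ω < t → t < θ 0 + r n * ω + ℓ →
      HasDerivAt (fun t => ψ (t + q n * ω) - ψ t)
        (semilinearField A f g (t + q n * ω) (ψ (t + q n * ω)) - semilinearField A f g t (ψ t))
        t := by
    intro n t h1 h2
    have h3 := RegularMoments.notMem_range hθ (hIoo (r n) t h1 h2)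
    exact ((hψ.hasDerivAt (mt (RegularMoments.add_natMul hθ (q n) t).mp h3)).comp_add_const t
      (q n * ω)).sub (hψ.hasDerivAt h3)
  have hex : ∀ n, ∃ t ∈ Icc (θ 0 + r n * ω + ℓ / 4) (θ 0 + r n * ω + 3 * ℓ / 4),
      η ≤ ‖ψ (t + q n * ω) - ψ t‖ := by
    intro n
    have key := exists_norm_ge_of_hasDerivAt (a := θ 0 + r n * ω + ℓ / 4)
      (b := θ 0 + r n * ω + 3 * ℓ / 4) (K := K) (by linarith) hK0 (hsep n)
      (fun t ht => hw n t (by linarith [ht.1]) (by linarith [ht.2])) ?_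
    · have e : θ 0 + r n * ω + 3 * ℓ / 4 - (θ 0 + r n * ω + ℓ / 4) = ℓ / 2 := by ring
      rwa [e] at key
    · intro t ht
      have h1 := hstep (r n) t (by linarith [ht.1]) (by linarith [ht.2])
      have e : semilinearField A f g (t + q n * ω) (ψ (t + q n * ω)) -
          semilinearField A f g t (ψ t) - (α (q n + r n) - α (r n)) =
          A (ψ (t + q n * ω) - ψ t) + (f t (ψ (t + q n * ω)) - f t (ψ t)) := by
        simp only [semilinearField]
        rw [step_add_natMul hθ hg (q n) h1, hg _ t h1, periodic_add_natMul hfp,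
          add_comm (r n : ℤ), map_sub]
        abel
      rw [e, add_mul]
      exact (norm_add_le _ _).trans (add_le_add (A.le_opNorm _) (hf _ _ _))
  choose τ hτ hητ using hex
  refine ⟨hψB, η / 2, ν, fun n => q n * ω, τ, by positivity, hν0, ?_, ?_, ?_, ?_, ?_⟩
  · exact (tendsto_natCast_atTop_atTop.comp hq).atTop_mul_const hω
  · refine tendsto_atTop_mono (fun n => ?_)
      (tendsto_atTop_add_const_left _ (θ 0)
        ((tendsto_natCast_atTop_atTop.comp hr).atTop_mul_const hω))
    simp only [Function.comp_apply]
    linarith [(hτ n).1]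
  · intro ε hε
    refine ⟨ε / (D + 1), by positivity, fun k s₁ h₁ s₂ h₂ h₁₂ => ?_⟩
    have h3 := hψ.norm_sub_le_of_mem_Ioo hθ hFD (k := k - 1) (by simpa using h₂)
      (by simpa using h₁)
    rw [lt_div_iff₀ (by positivity)] at h₁₂
    nlinarith [abs_nonneg (s₁ - s₂)]
  · exact fun K hK => hP.tendsto_shift hθ hC hκ hfp hf hh hconv hg hR hψ hK
  · intro n t ht
    have hν1 : ν ≤ ℓ / 8 := min_le_left _ _
    have hν2 : ν ≤ η / (4 * (D + 1)) := min_le_right _ _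
    rw [le_div_iff₀ (by positivity)] at hν2
    have hlip : ‖(ψ (t + q n * ω) - ψ t) - (ψ (τ n + q n * ω) - ψ (τ n))‖ ≤
        2 * D * |t - τ n| := by
      refine (convex_Ioo (θ 0 + r n * ω) (θ 0 + r n * ω + ℓ)
        ).norm_image_sub_le_of_norm_hasDerivWithin_le (C := 2 * D)
        (f := fun t => ψ (t + q n * ω) - ψ t)
        (fun u hu => (hw n u hu.1 hu.2).hasDerivWithinAt) (fun u _ => ?_) ?_ ?_
      · linarith [norm_sub_le (semilinearField A f g (u + q n * ω) (ψ (u + q n * ω)))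
          (semilinearField A f g u (ψ u)), hFD u, hFD (u + q n * ω)]
      · constructor <;> linarith [(hτ n).1, (hτ n).2]
      · constructor <;> linarith [(hτ n).1, (hτ n).2, ht.1, ht.2]
    have h1 : |t - τ n| ≤ ν := abs_le.mpr ⟨by linarith [ht.1], by linarith [ht.2]⟩
    have h2 : 2 * D * |t - τ n| ≤ η / 2 := by nlinarith [abs_nonneg (t - τ n)]
    have h3 := norm_sub_norm_le (ψ (τ n + q n * ω) - ψ (τ n)) (ψ (t + q n * ω) - ψ t)
    rw [norm_sub_rev (ψ (τ n + q n * ω) - ψ (τ n))] at h3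
    change η / 2 ≤ ‖ψ (t + q n * ω) - ψ t‖
    linarith [hητ n]

/-! ### Uniqueness, stability and asymptotic comparison. -/

theorem tendsto_exp_decay {κ : ℝ} (hκ : 0 < κ) (c s : ℝ) :
    Tendsto (fun t => c * Real.exp (-κ * (t - s))) atTop (𝓝 0) := by
  rw [← mul_zero c]
  exact Tendsto.const_mul _ (Real.tendsto_exp_atBot.comp
    ((tendsto_atTop_add_const_right _ (-s) tendsto_id).const_mul_atTop_of_neg
      (neg_lt_zero.mpr hκ)))

/-- Compare from time `-r`, where the difference is at most `R`, and let `r → ∞`. -/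
theorem PerturbationBound.eq_of_bounded {A B : E →L[ℝ] E} {Lf Lh C κ : ℝ}
    (hP : PerturbationBound θ A B Lf Lh C κ) (hκ : 0 < κ) {f : ℝ → E → E} {h : E → E}
    (hf : ∀ t x y, ‖f t x - f t y‖ ≤ Lf * ‖x - y‖) (hh : ∀ x y, ‖h x - h y‖ ≤ Lh * ‖x - y‖)
    {g : ℝ → E} {γ : ℤ → E} {x y : ℝ → E}
    (hx : IsImpulsiveSolution θ (semilinearField A f g) (semilinearJump B h γ) univ x)
    (hy : IsImpulsiveSolution θ (semilinearField A f g) (semilinearJump B h γ) univ y)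
    {R : ℝ} (hR : ∀ t, ‖x t - y t‖ ≤ R) : x = y := by
  have hR0 : 0 ≤ R := (norm_nonneg _).trans (hR 0)
  funext t
  have h1 : ∀ᶠ r : ℝ in atTop, ‖x t - y t‖ ≤ C * (R + 1) * Real.exp (-κ * (r - -t)) := by
    filter_upwards [eventually_ge_atTop (-t)] with r hr
    have h2 := hP.norm_solution_sub_le hf hh (hx.mono (subset_univ (Ici (-r))))
      (hy.mono (subset_univ (Ici (-r)))) (T := t) (δ := R + 1) le_rfl (by positivity)
      ((hR (-r)).trans (by linarith)) (fun u _ => by simp) (fun k _ => by simp)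
      (t := t) ⟨by linarith, le_rfl⟩
    refine h2.trans (le_of_eq ?_)
    ring_nf
  have h2 := ge_of_tendsto (tendsto_exp_decay hκ (C * (R + 1)) (-t)) h1
  exact sub_eq_zero.mp (norm_le_zero_iff.mp h2)

theorem PerturbationBound.isAsymptoticallyStable {A B : E →L[ℝ] E} {Lf Lh C κ : ℝ}
    (hP : PerturbationBound θ A B Lf Lh C κ) (hC : 0 < C) (hκ : 0 < κ) {f : ℝ → E → E}
    {h : E → E}
    (hf : ∀ t x y, ‖f t x - f t y‖ ≤ Lf * ‖x - y‖) (hh : ∀ x y, ‖h x - h y‖ ≤ Lh * ‖x - y‖)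
    {g : ℝ → E} {γ : ℤ → E} {φ : ℝ → E}
    (hφ : IsImpulsiveSolution θ (semilinearField A f g) (semilinearJump B h γ) univ φ) :
    IsAsymptoticallyStable θ (semilinearField A f g) (semilinearJump B h γ) φ := by
  intro t₀
  have key : ∀ δ > 0, ∀ x, IsImpulsiveSolution θ (semilinearField A f g)
      (semilinearJump B h γ) (Ici t₀) x → ‖x t₀ - φ t₀‖ < δ → ∀ t ≥ t₀,
      ‖x t - φ t‖ ≤ C * δ * Real.exp (-κ * (t - t₀)) := by
    intro δ hδ x hx hxφ t ht
    have h2 := hP.norm_solution_sub_le hf hh hx (hφ.mono (subset_univ _)) (T := t) le_rfl hδ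
      hxφ.le (fun u _ => by simp) (fun k _ => by simp) (t := t) ⟨ht, le_rfl⟩
    rwa [add_zero, ← mul_assoc] at h2
  refine ⟨fun ε hε => ⟨ε / (2 * C), by positivity, fun x hx hxφ t ht => ?_⟩,
    ⟨1, one_pos, fun x hx hxφ => ?_⟩⟩
  · refine (key _ (by positivity) x hx hxφ t ht).trans_lt ?_
    have h1 : C * (ε / (2 * C)) = ε / 2 := by field_simp
    have h2 : Real.exp (-κ * (t - t₀)) ≤ 1 := by
      rw [Real.exp_le_one_iff]
      nlinarith
    rw [h1]
    nlinarith
  · refine squeeze_zero' (Eventually.of_forall fun t => norm_nonneg _) ?_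
      (tendsto_exp_decay hκ (C * 1) t₀)
    filter_upwards [eventually_ge_atTop t₀] with t ht using key 1 one_pos x hx hxφ t ht

/-- Restart the comparison at a time after which the forcings differ by at most `ε / (2 * C)`; the
other `ε / 2` covers the decaying transient. -/
theorem PerturbationBound.tendsto_norm_sub (hθ : θ ∈ RegularMoments p ω) {A B : E →L[ℝ] E}
    {Lf Lh C κ : ℝ} (hP : PerturbationBound θ A B Lf Lh C κ) (hC : 0 < C) (hκ : 0 < κ)
    {f : ℝ → E → E} {h : E → E}
    (hf : ∀ t x y, ‖f t x - f t y‖ ≤ Lf * ‖x - y‖) (hh : ∀ x y, ‖h x - h y‖ ≤ Lh * ‖x - y‖)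
    {g₁ g₂ : ℝ → E} {γ₁ γ₂ : ℤ → E} {x y : ℝ → E}
    (hx : IsImpulsiveSolution θ (semilinearField A f g₁) (semilinearJump B h γ₁) univ x)
    (hy : IsImpulsiveSolution θ (semilinearField A f g₂) (semilinearJump B h γ₂) univ y)
    (hg : Tendsto (fun t => ‖g₁ t - g₂ t‖) atTop (𝓝 0))
    (hγ : Tendsto (fun k => ‖γ₁ k - γ₂ k‖) atTop (𝓝 0)) :
    Tendsto (fun t => ‖x t - y t‖) atTop (𝓝 0) := by
  rw [Metric.tendsto_nhds]
  intro ε hε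
  have hε' : 0 < ε / (2 * C) := by positivity
  obtain ⟨s₁, hs₁⟩ := eventually_atTop.mp (hg.eventually_le_const hε')
  obtain ⟨k₁, hk₁⟩ := eventually_atTop.mp (hγ.eventually_le_const hε')
  set s := max s₁ (θ k₁) with hs
  set δ := ‖x s - y s‖ + 1 with hδ
  filter_upwards [eventually_ge_atTop s,
    (tendsto_exp_decay hκ (C * δ) s).eventually_lt_const (half_pos hε)] with t ht htε
  have h2 := hP.norm_solution_sub_le hf hh (hx.mono (subset_univ (Ici s)))
    (hy.mono (subset_univ (Ici s))) (T := t) hε'.le (δ := δ) (by positivity)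
    (le_add_of_nonneg_right zero_le_one) (fun u hu => hs₁ u ((le_max_left _ _).trans hu.1))
    (fun k hk => hk₁ k (hθ.2.2.1.le_iff_le.mp ((le_max_right _ _).trans hk.1)))
    (t := t) ⟨ht, le_rfl⟩
  rw [dist_zero_right, norm_norm]
  have h1 : C * (ε / (2 * C)) = ε / 2 := by field_simp
  rw [mul_add, h1, ← mul_assoc] at h2
  linarith

theorem tendsto_step (hθ : θ ∈ RegularMoments p ω) {β : ℤ → E}
    (hβ : Tendsto (fun k => ‖β k‖) atTop (𝓝 0)) {g : ℝ → E}
    (hg : ∀ k : ℤ, ∀ t ∈ Ioc (θ (k * p)) (θ ((k + 1) * p)), g t = β k) :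
    Tendsto (fun t => ‖g t‖) atTop (𝓝 0) := by
  have hθ' := RegularMoments.comp_mul hθ
  rw [Metric.tendsto_nhds] at hβ ⊢
  intro ε hε
  obtain ⟨k₀, hk₀⟩ := eventually_atTop.mp (hβ ε hε)
  filter_upwards [eventually_gt_atTop (θ (k₀ * p))] with t ht
  obtain ⟨k, hk⟩ := RegularMoments.exists_mem_Ioc hθ' t
  rw [hg k t hk]
  have := hθ'.2.2.1.lt_iff_lt.mp (ht.trans_le hk.2)
  exact hk₀ k (by omega)

end

/-! ### Assembly of the theorem. -/

theorem mainTheorem1 {m p : ℕ} {ω : ℝ} {θ : ℤ → ℝ} (hθ : θ ∈ RegularMoments p ω)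
    -- the data of the system
    (A B : Matrix (Fin m) (Fin m) ℝ) (hAB : Commute A B)
    (f : ℝ → EuclideanSpace ℝ (Fin m) → EuclideanSpace ℝ (Fin m))
    (hf : Continuous (Function.uncurry f))
    (h : EuclideanSpace ℝ (Fin m) → EuclideanSpace ℝ (Fin m)) (hh : Continuous h)
    (γ : ℤ → EuclideanSpace ℝ (Fin m)) (hγ_bdd : ∃ C : ℝ, ∀ k, ‖γ k‖ ≤ C)
    (hγ : Tendsto (fun k => ‖γ k‖) atTop (𝓝 0))
    (σ : ℤ → EuclideanSpace ℝ (Fin m))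
    (g₁ : ℝ → EuclideanSpace ℝ (Fin m))
    (hg₁ : ∀ k : ℤ, ∀ t ∈ Ioc (θ (k * p)) (θ ((k + 1) * p)), g₁ t = σ k)
    (g₂ : ℝ → EuclideanSpace ℝ (Fin m)) (hg₂_mem : g₂ ∈ BPC θ)
    (hg₂ : Tendsto (fun t => ‖g₂ t‖) atTop (𝓝 0))
    -- (A1)
    (A1 : (1 + B).det ≠ 0)
    -- (A2)
    (A2 : ∃ L : Matrix (Fin m) (Fin m) ℂ, IsPrincipalLog ((1 + B).map Complex.ofReal) L ∧
      ∀ z ∈ spectrum ℂ (A.map Complex.ofReal + ((p / ω : ℝ) : ℂ) • L), z.re < 0)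
    -- (A3)
    (A3 : ∀ t x, f (t + ω) x = f t x)
    -- (A4)
    {M_f M_h : ℝ} (hM_f : 0 < M_f) (hM_h : 0 < M_h)
    (A4_f : ∀ t ∈ Ico 0 ω, ∀ x, ‖f t x‖ ≤ M_f) (A4_h : ∀ x, ‖h x‖ ≤ M_h)
    -- (A5)
    {L_f L_h : ℝ} (hL_f : 0 < L_f) (hL_h : 0 < L_h)
    (A5_f : ∀ t x₁ x₂, ‖f t x₁ - f t x₂‖ ≤ L_f * ‖x₁ - x₂‖)
    (A5_h : ∀ x₁ x₂, ‖h x₁ - h x₂‖ ≤ L_h * ‖x₁ - x₂‖)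
    -- the constants `N` and `lam` of the exponential estimate of the matriciant
    {N lam : ℝ} (hN : 1 ≤ N) (hlam : 0 < lam)
    (hU : ∀ t s : ℝ, s ≤ t → ‖matriciant A B θ t s‖ ≤ N * Real.exp (-lam * (t - s)))
    -- (A6)
    (A6 : N * (L_f / lam + p * L_h / (1 - Real.exp (-lam * ω))) < 1)
    -- (A7)
    (A7 : N * L_f + p / ω * Real.log (1 + N * L_h) < lam)
    -- (A8)
    (A8 : L_h * ‖(1 + B)⁻¹‖ < 1)
    (hσ : IsAsymptoticallyUnpredictableSeq σ) :
    ∃ φ : ℝ → EuclideanSpace ℝ (Fin m),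
      (IsImpulsiveSolution θ (quasilinearField A f g₁ g₂) (quasilinearJump B h γ) univ φ ∧
        IsAsymptoticallyUnpredictable θ φ) ∧
      (∀ y : ℝ → EuclideanSpace ℝ (Fin m),
        IsImpulsiveSolution θ (quasilinearField A f g₁ g₂) (quasilinearJump B h γ) univ y →
        IsAsymptoticallyUnpredictable θ y → y = φ) ∧
      IsAsymptoticallyStable θ (quasilinearField A f g₁ g₂) (quasilinearJump B h γ) φ := by
  obtain ⟨⟨Mσ, hMσ⟩, α, β, hα, hβ, hσαβ⟩ := hσ
  obtain ⟨Mα, hMα⟩ := hα.1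
  obtain ⟨Mγ, hMγ⟩ := hγ_bdd
  set A' := Matrix.toEuclideanCLM (n := Fin m) (𝕜 := ℝ) A with hA'
  set B' := Matrix.toEuclideanCLM (n := Fin m) (𝕜 := ℝ) B with hB'
  have hAB' : Commute A' B' := hAB.map (Matrix.toEuclideanCLM (n := Fin m) (𝕜 := ℝ))
  have hU' : ∀ t s : ℝ, s ≤ t → ‖evolution A' B' θ t s‖ ≤ N * Real.exp (-lam * (t - s)) := by
    intro t s hst
    rw [← toEuclideanCLM_matriciant, Matrix.l2_opNorm_toEuclideanCLM]
    exact hU t s hst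
  have hfM : ∀ t x, ‖f t x‖ ≤ M_f := by
    intro t x
    obtain ⟨u, hu, hfu⟩ := Function.Periodic.exists_mem_Ico₀
      (show Function.Periodic (fun t => f t x) ω from fun t => A3 t x) hθ.2.1 t
    exact (congrArg norm hfu).trans_le (A4_f u hu x)
  obtain ⟨C, κ, hC, hκ, hP⟩ := exists_perturbationBound hθ hAB' hN hlam hU' hL_f.le hL_h.le A6
  have hF : quasilinearField A f g₁ g₂ = semilinearField A' f (fun t => g₁ t + g₂ t) := by
    funext t x
    simp only [quasilinearField, semilinearField, hA', add_assoc]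
  have hG : quasilinearJump B h γ = semilinearJump B' h γ := rfl
  rw [hF, hG]
  obtain ⟨φ, hφB, hφ⟩ := hP.exists_solution hθ hC hκ hL_f.le hL_h.le hf hh A5_f A5_h hfM A4_h
    (BPC.add (step_mem_BPC hθ hMσ hg₁) hg₂_mem) hMγ
  -- The unpredictable part of `φ` is the bounded solution driven by `α`, with `g₂` and `γ` dropped.
  obtain ⟨gα, hgα⟩ := exists_step hθ α
  obtain ⟨ψ, hψB, hψ⟩ := hP.exists_solution hθ hC hκ hL_f.le hL_h.le hf hh A5_f A5_h hfM A4_h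
    (step_mem_BPC hθ hMα hgα) (γ := 0) (Mγ := 0) (by simp)
  have hψu := hP.isUnpredictable hθ hC hκ hL_f.le A3 A5_f A5_h hfM hα hgα hψB hψ
  have hstepβ : Tendsto (fun t => ‖g₁ t - gα t‖) atTop (𝓝 0) := by
    refine tendsto_step hθ hβ (g := fun t => g₁ t - gα t) fun k t ht => ?_
    rw [hg₁ k t ht, hgα k t ht, hσαβ k, add_sub_cancel_left]
  have hg : Tendsto (fun t => ‖g₁ t + g₂ t - gα t‖) atTop (𝓝 0) := by
    refine squeeze_zero (fun t => norm_nonneg _) (fun t => ?_) (by simpa using hstepβ.add hg₂)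
    rw [add_sub_right_comm]
    exact norm_add_le _ _
  have hξ : Tendsto (fun t => ‖φ t - ψ t‖) atTop (𝓝 0) :=
    hP.tendsto_norm_sub hθ hC hκ A5_f A5_h hφ hψ hg (by simpa using hγ)
  refine ⟨φ, ⟨hφ, hφB, ψ, fun t => φ t - ψ t, hψu, ?_, hξ, fun t => (add_sub_cancel _ _).symm⟩, ?_,
    hP.isAsymptoticallyStable hC hκ A5_f A5_h hφ⟩
  · simpa only [sub_eq_add_neg] using BPC.add hφB (BPC.neg hψB)
  · intro y hy hyu
    obtain ⟨Ry, hRy⟩ := hyu.1.1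
    obtain ⟨Rφ, hRφ⟩ := hφB.1
    exact hP.eq_of_bounded hκ A5_f A5_h hy hφ (R := Ry + Rφ) fun t =>
      (norm_sub_le _ _).trans (add_le_add (hRy t) (hRφ t))
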